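/- Let $k$ be an algebraically closed field of characteristic $0$, let $q\in k^\times$ with $q\neq\pm1$, and let $N\ge 3$. Let $\mathcal O_q(M_N(k))$ be the $k$-algebra generated by $Y_{ij}$, $1\le i,j\le N$, with relations \[ Y_{ij}Y_{\ell m}=\begin{cases} q\,Y_{\ell m}Y_{ij} & (i<\ell,\ j=m),\\ q\,Y_{\ell m}Y_{ij} & (i=\ell,\ j<m),\\ Y_{\ell m}Y_{ij} & (i<\ell,\ j>m),\\ Y_{\ell m}Y_{ij}+(q-q^{-1})Y_{im}Y_{\ell j} & (i<\ell,\ j<m),\end{cases} \] and let $(k^\times)^{2N-1}\rtimes\langle\tau\rangle$ denote the subgroup of $\mathrm{Aut}(\mathcal O_q(M_N(k)))$ generated by the automorphisms $Y_{ij}\mapsto a_ib_jY_{ij}$ ($a_1,\dots,a_N,b_1,\dots,b_{N-1}\in k^\times$, $b_N=1$) and the transposition $\tau\colon Y_{ij}\mapsto Y_{ji}$. Let $G$ be a finite abelian group, $\theta\in\mathbb N$, $g_1,\dots,g_\theta\in G$, and let $\chi_1,\dots,\chi_\theta\colon G\to k^\times$ be characters such that $\chi_i(g_j)=\chi_j(g_i)^{-1}$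 for $i\neq j$ and such that each $\chi_i(g_i)$ has order $m_i\ge2$. Let $B(G,\underline g,\underline\chi)$ (of rank $\theta$) be the Hopf algebra generated by $G$ and $x_1,\dots,x_\theta$ with the relations of $G$ and \[ x_i^{m_i}=0,\qquad x_ix_j=\chi_j(g_i)\,x_jx_i\ (i\ne j),\qquad hx_i=\chi_i(h)\,x_ih\ (h\in G), \] with $\Delta(h)=h\otimes h$ for $h\in G$ and $\Delta(x_i)=g_i\otimes x_i+x_i\otimes 1$. Assume that $m_i\neq2$ for all $i$, and that $\mathcal O_q(M_N(k))$ is a left $B(G,\underline g,\underline\chi)$-module algebra such that, for every $i$, $g_i$ acts as an element of $(k^\times)^{2N-1}\rtimes\langle\tau\rangle$, and $x_i$ acts by a nonzero operator that maps the span of the generators $Y_{ab}$ into itself. Then $\theta\le 2N-2$. -/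

import Mathlib

open scoped TensorProduct

/-! ### The vanishing of intermediate Gaussian binomial coefficients at a root of unity -/

/-- Gaussian binomial coefficients evaluated at `l`, through the Pascal rule. -/
def gaussCoeff {k : Type*} [Field k] (l : k) : ℕ → ℕ → k
  | _, 0 => 1
  | 0, _ + 1 => 0
  | n + 1, j + 1 => gaussCoeff l n j + l ^ (j + 1) * gaussCoeff l n (j + 1)

theorem gaussCoeff_succ_succ {k : Type*} [Field k] (l : k) (n j : ℕ) :
    gaussCoeff l (n + 1) (j + 1) =
      gaussCoeff l n j + l ^ (j + 1) * gaussCoeff l n (j + 1) := by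
  rw [gaussCoeff]

theorem gaussCoeff_zero {k : Type*} [Field k] (l : k) (n : ℕ) : gaussCoeff l n 0 = 1 := by
  cases n <;> rw [gaussCoeff]

theorem gaussCoeff_eq_zero {k : Type*} [Field k] (l : k) :
    ∀ n j : ℕ, n < j → gaussCoeff l n j = 0
  | _, 0, h => absurd h (Nat.not_lt_zero _)
  | 0, j + 1, _ => by rw [gaussCoeff]
  | n + 1, j + 1, h => by
      rw [gaussCoeff_succ_succ, gaussCoeff_eq_zero l n j (by omega),
        gaussCoeff_eq_zero l n (j + 1) (by omega)]
      ring

theorem gaussCoeff_self {k : Type*} [Field k] (l : k) : ∀ n : ℕ, gaussCoeff l n n = 1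
  | 0 => gaussCoeff_zero l 0
  | n + 1 => by
      rw [gaussCoeff_succ_succ, gaussCoeff_self l n, gaussCoeff_eq_zero l n (n + 1) (by omega)]
      ring

theorem gaussCoeff_ratio {k : Type*} [Field k] (l : k) (n j : ℕ) :
    (l ^ j - l ^ j * l ^ (j + 1)) * gaussCoeff l n (j + 1) =
      (l ^ j - l ^ n) * gaussCoeff l n j := by
  induction n generalizing j with
  | zero =>
    rw [gaussCoeff_eq_zero l 0 (j + 1) (by omega)]
    rcases j with _ | j
    · ring
    · rw [gaussCoeff_eq_zero l 0 (j + 1) (by omega)]; ring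
  | succ n ih =>
    rw [gaussCoeff_succ_succ]
    rcases j with _ | j
    · have h := ih 0
      rw [gaussCoeff_zero] at h
      rw [gaussCoeff_zero, gaussCoeff_zero]
      linear_combination l * h
    · have h1 := ih (j + 1)
      have h2 := ih j
      rw [gaussCoeff_succ_succ]
      linear_combination l ^ (j + 2) * h1 + l * h2

theorem gaussCoeff_orderOf {k : Type*} [Field k] (l : kˣ) (j : ℕ) (hj : j + 1 < orderOf l) :
    gaussCoeff (l : k) (orderOf l) (j + 1) = 0 := by
  have key : ∀ i : ℕ, i + 1 < orderOf l → (1 : k) - (l : k) ^ (i + 1) ≠ 0 := by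
    intro i hi h
    have h1 : l ^ (i + 1) = 1 := by
      apply Units.ext
      push_cast
      exact (sub_eq_zero.mp h).symm
    exact absurd (orderOf_le_of_pow_eq_one (Nat.succ_pos i) h1) (by omega)
  have hl : ∀ i : ℕ, (l : k) ^ i ≠ 0 := fun i => pow_ne_zero _ l.ne_zero
  have step : ∀ i : ℕ, i + 1 < orderOf l →
      ((l : k) ^ i - (l : k) ^ orderOf l) * gaussCoeff (l : k) (orderOf l) i = 0 →
      gaussCoeff (l : k) (orderOf l) (i + 1) = 0 := by
    intro i hi h
    have h1 := gaussCoeff_ratio (l : k) (orderOf l) i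
    rw [h] at h1
    have h2 : (l : k) ^ i - (l : k) ^ i * (l : k) ^ (i + 1) ≠ 0 := by
      have h3 := mul_ne_zero (hl i) (key i hi)
      intro h4
      exact h3 (by linear_combination h4)
    exact (mul_eq_zero.mp h1).resolve_left h2
  induction j with
  | zero =>
    refine step 0 hj ?_
    have h : (l : k) ^ orderOf l = 1 := by
      rw [← Units.val_pow_eq_pow_val, pow_orderOf_eq_one, Units.val_one]
    rw [h]
    ring
  | succ j ih => exact step (j + 1) hj (by rw [ih (by omega)]; ring)

/-- The `q`-binomial formula. -/
theorem add_pow_gauss {k R : Type*} [Field k] [Ring R] [Algebra k R] (l : k) (X Y : R)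
    (h : X * Y = l • (Y * X)) (n : ℕ) :
    (Y + X) ^ n =
      ∑ j ∈ Finset.range (n + 1), gaussCoeff l n j • (Y ^ j * X ^ (n - j)) := by
  have hX : ∀ j : ℕ, X * Y ^ j = l ^ j • (Y ^ j * X) := by
    intro j
    induction j with
    | zero => simp
    | succ j ih =>
      rw [pow_succ, ← mul_assoc, ih, smul_mul_assoc, mul_assoc, h, mul_smul_comm, smul_smul,
        ← mul_assoc, pow_succ]
  induction n with
  | zero => simp [gaussCoeff_zero]
  | succ n ih =>
    rw [pow_succ', ih, add_mul, Finset.mul_sum, Finset.mul_sum]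
    have e1 : ∀ j ∈ Finset.range (n + 1),
        X * gaussCoeff l n j • (Y ^ j * X ^ (n - j)) =
          (l ^ j * gaussCoeff l n j) • (Y ^ j * X ^ (n + 1 - j)) := by
      intro j hj
      rw [Finset.mem_range] at hj
      rw [mul_smul_comm, ← mul_assoc, hX, smul_mul_assoc, smul_smul, mul_assoc, ← pow_succ',
        mul_comm (l ^ j), show n - j + 1 = n + 1 - j by omega]
    have e2 : ∀ j ∈ Finset.range (n + 1),
        Y * gaussCoeff l n j • (Y ^ j * X ^ (n - j)) =
          gaussCoeff l n j • (Y ^ (j + 1) * X ^ (n + 1 - (j + 1))) := by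
      intro j hj
      rw [mul_smul_comm, ← mul_assoc, ← pow_succ', Nat.add_sub_add_right]
    rw [Finset.sum_congr rfl e1, Finset.sum_congr rfl e2, Finset.sum_range_succ' _ (n + 1)]
    have e3 : ∑ j ∈ Finset.range (n + 1),
        (l ^ j * gaussCoeff l n j) • (Y ^ j * X ^ (n + 1 - j)) =
        ∑ j ∈ Finset.range (n + 1),
          (l ^ (j + 1) * gaussCoeff l n (j + 1)) • (Y ^ (j + 1) * X ^ (n + 1 - (j + 1))) +
        (Y ^ 0 * X ^ (n + 1 - 0)) := by
      rw [Finset.sum_range_succ' _ n, Finset.sum_range_succ _ n,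
        gaussCoeff_eq_zero l n (n + 1) (by omega), gaussCoeff_zero]
      simp
    rw [e3, ← add_assoc, ← Finset.sum_add_distrib, gaussCoeff_zero, one_smul]
    congr 1
    refine Finset.sum_congr rfl fun j _ => ?_
    rw [gaussCoeff_succ_succ, add_smul]

theorem add_pow_orderOf {k R : Type*} [Field k] [Ring R] [Algebra k R] (l : kˣ) (X Y : R)
    (hl : 1 ≤ orderOf l) (h : X * Y = (l : k) • (Y * X)) :
    (Y + X) ^ orderOf l = X ^ orderOf l + Y ^ orderOf l := by
  rw [add_pow_gauss (l : k) X Y h, Finset.sum_range_succ, gaussCoeff_self]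
  obtain ⟨m, hm⟩ : ∃ m, orderOf l = m + 1 := ⟨orderOf l - 1, by omega⟩
  rw [show Finset.range (orderOf l) = Finset.range (m + 1) by rw [hm], Finset.sum_range_succ']
  rw [Finset.sum_eq_zero]
  · simp [gaussCoeff_zero]
  · intro j hj
    rw [Finset.mem_range] at hj
    rw [gaussCoeff_orderOf l j (by omega), zero_smul]

/-! ### Bosonizations of quantum linear spaces -/

/-- The datum of a quantum linear space of rank `θ` over the abelian group `G`: elements `g i` of
`G` and characters `χ i` of `G` with `χ i (g j) = (χ j (g i))⁻¹` for `i ≠ j`, such that the order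
`m i` of `χ i (g i)` is at least `2` (Mathlib gives order `0` to elements of infinite order, so
finiteness of the order is included). -/
structure QLSDatum (k G : Type*) [Field k] [CommGroup G] (θ : ℕ) where
  g : Fin θ → G
  χ : Fin θ → (G →* kˣ)
  compat : ∀ i j, i ≠ j → χ i (g j) = (χ j (g i))⁻¹
  two_le_orderOf : ∀ i, 2 ≤ orderOf (χ i (g i))

namespace QLSDatum

/-- `m i` is the order of `χ i (g i)`. -/
noncomputable def m {k G : Type*} [Field k] [CommGroup G] {θ : ℕ} (D : QLSDatum k G θ)
    (i : Fin θ) : ℕ := orderOf (D.χ i (D.g i))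

/-- The defining relations of the bosonization, on the free algebra on `G` (`Sum.inl`) and
on the letters `x i` (`Sum.inr`). -/
inductive Rel {k G : Type*} [Field k] [CommGroup G] {θ : ℕ} (D : QLSDatum k G θ) :
    FreeAlgebra k (G ⊕ Fin θ) → FreeAlgebra k (G ⊕ Fin θ) → Prop
  | one : Rel D (FreeAlgebra.ι k (Sum.inl 1)) 1
  | mul (a b : G) : Rel D (FreeAlgebra.ι k (Sum.inl (a * b)))
      (FreeAlgebra.ι k (Sum.inl a) * FreeAlgebra.ι k (Sum.inl b))
  | pow (i : Fin θ) : Rel D (FreeAlgebra.ι k (Sum.inr i) ^ D.m i) 0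
  | braid (i j : Fin θ) (hij : i ≠ j) :
      Rel D (FreeAlgebra.ι k (Sum.inr i) * FreeAlgebra.ι k (Sum.inr j))
        ((D.χ j (D.g i) : k) •
          (FreeAlgebra.ι k (Sum.inr j) * FreeAlgebra.ι k (Sum.inr i)))
  | conj (h : G) (i : Fin θ) :
      Rel D (FreeAlgebra.ι k (Sum.inl h) * FreeAlgebra.ι k (Sum.inr i))
        ((D.χ i h : k) • (FreeAlgebra.ι k (Sum.inr i) * FreeAlgebra.ι k (Sum.inl h)))

/-- The bosonization `B(G, g, χ)`, as an algebra by generators and relations; its Hopf algebra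
structure is the instance `QLSDatum.instHopfAlgebra` below. -/
def Boson {k G : Type*} [Field k] [CommGroup G] {θ : ℕ} (D : QLSDatum k G θ) : Type _ :=
  RingQuot D.Rel

noncomputable instance {k G : Type*} [Field k] [CommGroup G] {θ : ℕ} (D : QLSDatum k G θ) :
    Ring D.Boson := inferInstanceAs (Ring (RingQuot D.Rel))

noncomputable instance {k G : Type*} [Field k] [CommGroup G] {θ : ℕ} (D : QLSDatum k G θ) :
    Algebra k D.Boson := inferInstanceAs (Algebra k (RingQuot D.Rel))

/-- The canonical map from the free algebra. -/
noncomputable def proj {k G : Type*} [Field k] [CommGroup G] {θ : ℕ} (D : QLSDatum k G θ) :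
    FreeAlgebra k (G ⊕ Fin θ) →ₐ[k] D.Boson := RingQuot.mkAlgHom k D.Rel

/-- The image in the bosonization of a group element. -/
noncomputable def grp {k G : Type*} [Field k] [CommGroup G] {θ : ℕ} (D : QLSDatum k G θ)
    (h : G) : D.Boson := D.proj (FreeAlgebra.ι k (Sum.inl h))

/-- The generators `x i` of the bosonization. -/
noncomputable def x {k G : Type*} [Field k] [CommGroup G] {θ : ℕ} (D : QLSDatum k G θ)
    (i : Fin θ) : D.Boson := D.proj (FreeAlgebra.ι k (Sum.inr i))

section Relations

variable {k G : Type*} [Field k] [CommGroup G] {θ : ℕ} (D : QLSDatum k G θ)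

theorem proj_rel {a b : FreeAlgebra k (G ⊕ Fin θ)} (h : D.Rel a b) : D.proj a = D.proj b :=
  RingQuot.mkAlgHom_rel k h

theorem grp_one : D.grp 1 = 1 := by
  have h := D.proj_rel Rel.one
  rwa [map_one] at h

theorem grp_mul (a b : G) : D.grp (a * b) = D.grp a * D.grp b := by
  have h := D.proj_rel (Rel.mul a b)
  rwa [map_mul] at h

theorem x_pow (i : Fin θ) : D.x i ^ D.m i = 0 := by
  have h := D.proj_rel (Rel.pow i)
  rwa [map_pow, map_zero] at h

theorem x_mul_x (i j : Fin θ) (hij : i ≠ j) :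
    D.x i * D.x j = (D.χ j (D.g i) : k) • (D.x j * D.x i) := by
  have h := D.proj_rel (Rel.braid i j hij)
  rwa [map_mul, map_smul, map_mul] at h

theorem grp_mul_x (h : G) (i : Fin θ) :
    D.grp h * D.x i = (D.χ i h : k) • (D.x i * D.grp h) := by
  have h := D.proj_rel (Rel.conj h i)
  rwa [map_mul, map_smul, map_mul] at h

/-- The universal property of the presentation. -/
noncomputable def lift {R : Type*} [Ring R] [Algebra k R] (u : G → R) (v : Fin θ → R)
    (h1 : u 1 = 1) (h2 : ∀ a b, u (a * b) = u a * u b) (h3 : ∀ i, v i ^ D.m i = 0)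
    (h4 : ∀ i j, i ≠ j → v i * v j = (D.χ j (D.g i) : k) • (v j * v i))
    (h5 : ∀ h i, u h * v i = (D.χ i h : k) • (v i * u h)) : D.Boson →ₐ[k] R :=
  RingQuot.liftAlgHom k ⟨FreeAlgebra.lift k (Sum.elim u v), by
    intro a b hab
    cases hab with
    | one => simp [h1]
    | mul a b => simp [h2]
    | pow i => simp [h3]
    | braid i j hij => simp [h4 i j hij]
    | conj h i => simp [h5]⟩

section
variable {R : Type*} [Ring R] [Algebra k R] (u : G → R) (v : Fin θ → R)
    (h1 : u 1 = 1) (h2 : ∀ a b, u (a * b) = u a * u b) (h3 : ∀ i, v i ^ D.m i = 0)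
    (h4 : ∀ i j, i ≠ j → v i * v j = (D.χ j (D.g i) : k) • (v j * v i))
    (h5 : ∀ h i, u h * v i = (D.χ i h : k) • (v i * u h))

theorem lift_grp (h : G) : D.lift u v h1 h2 h3 h4 h5 (D.grp h) = u h := by
  have e : D.lift u v h1 h2 h3 h4 h5 (D.grp h) =
      FreeAlgebra.lift k (Sum.elim u v) (FreeAlgebra.ι k (Sum.inl h)) :=
    RingQuot.liftAlgHom_mkAlgHom_apply k _ _ _
  rw [e, FreeAlgebra.lift_ι_apply, Sum.elim_inl]

theorem lift_x (i : Fin θ) : D.lift u v h1 h2 h3 h4 h5 (D.x i) = v i := by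
  have e : D.lift u v h1 h2 h3 h4 h5 (D.x i) =
      FreeAlgebra.lift k (Sum.elim u v) (FreeAlgebra.ι k (Sum.inr i)) :=
    RingQuot.liftAlgHom_mkAlgHom_apply k _ _ _
  rw [e, FreeAlgebra.lift_ι_apply, Sum.elim_inr]

end

variable {D} in
theorem algHom_ext {R : Type*} [Ring R] [Algebra k R] {φ ψ : D.Boson →ₐ[k] R}
    (h1 : ∀ h, φ (D.grp h) = ψ (D.grp h)) (h2 : ∀ i, φ (D.x i) = ψ (D.x i)) : φ = ψ := by
  refine RingQuot.ringQuot_ext' (S := k) (s := D.Rel) φ ψ (FreeAlgebra.hom_ext ?_)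
  funext z
  cases z with
  | inl h => exact h1 h
  | inr i => exact h2 i

variable {D} in
theorem induction {P : D.Boson → Prop} (hs : ∀ c : k, P (algebraMap k D.Boson c))
    (hg : ∀ h, P (D.grp h)) (hx : ∀ i, P (D.x i)) (hm : ∀ a b, P a → P b → P (a * b))
    (ha : ∀ a b, P a → P b → P (a + b)) (b : D.Boson) : P b := by
  obtain ⟨a, rfl⟩ := RingQuot.mkAlgHom_surjective k D.Rel b
  change P (D.proj a)
  induction a using FreeAlgebra.induction with
  | grade0 c => rw [AlgHom.commutes]; exact hs c
  | grade1 z =>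
    cases z with
    | inl h => exact hg h
    | inr i => exact hx i
  | mul a b iha ihb => rw [map_mul]; exact hm _ _ iha ihb
  | add a b iha ihb => rw [map_add]; exact ha _ _ iha ihb

theorem m_ne_zero (i : Fin θ) : D.m i ≠ 0 := by
  have := D.two_le_orderOf i
  unfold m
  omega

theorem chi_mul_chi (i j : Fin θ) (hij : i ≠ j) :
    (D.χ i (D.g j) : k) * (D.χ j (D.g i) : k) = 1 := by
  rw [D.compat i j hij]
  simp

theorem comul_mul (a b : G) : D.grp (a * b) ⊗ₜ[k] D.grp (a * b) =
    (D.grp a ⊗ₜ[k] D.grp a) * (D.grp b ⊗ₜ[k] D.grp b) := by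
  rw [Algebra.TensorProduct.tmul_mul_tmul, grp_mul]

/-- The comultiplication: `Δ h = h ⊗ h` for `h` in `G`, and `Δ x_i = g_i ⊗ x_i + x_i ⊗ 1`. -/
noncomputable def comulHom : D.Boson →ₐ[k] D.Boson ⊗[k] D.Boson :=
  D.lift (fun h => D.grp h ⊗ₜ[k] D.grp h)
    (fun i => D.grp (D.g i) ⊗ₜ[k] D.x i + D.x i ⊗ₜ[k] 1)
    (by simp only [grp_one, Algebra.TensorProduct.one_def])
    D.comul_mul
    (by
      intro i
      have h := add_pow_orderOf (k := k) (D.χ i (D.g i)) (D.grp (D.g i) ⊗ₜ[k] D.x i)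
        (D.x i ⊗ₜ[k] (1 : D.Boson)) (by have := D.two_le_orderOf i; omega)
        (by simp only [Algebra.TensorProduct.tmul_mul_tmul, grp_mul_x, mul_one, one_mul,
              TensorProduct.smul_tmul'])
      have hx := D.x_pow i
      unfold m at hx ⊢
      rw [add_comm, h, Algebra.TensorProduct.tmul_pow, Algebra.TensorProduct.tmul_pow, hx]
      simp)
    (by
      intro i j hij
      have c1 := D.chi_mul_chi i j hij
      have e1 : D.x i * D.grp (D.g j) = (D.χ j (D.g i) : k) • (D.grp (D.g j) * D.x i) := by
        rw [grp_mul_x, smul_smul, mul_comm, c1, one_smul]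
      simp only [mul_add, add_mul, Algebra.TensorProduct.tmul_mul_tmul, mul_one, one_mul,
        smul_add, D.x_mul_x i j hij, D.grp_mul_x (D.g i) j, e1, TensorProduct.smul_tmul',
        TensorProduct.tmul_smul, ← D.grp_mul, mul_comm (D.g j) (D.g i)]
      abel)
    (by
      intro h i
      simp only [mul_add, add_mul, Algebra.TensorProduct.tmul_mul_tmul, mul_one, one_mul,
        smul_add, D.grp_mul_x h i, TensorProduct.smul_tmul',
        TensorProduct.tmul_smul, ← D.grp_mul, mul_comm h (D.g i)])

/-- The counit: `ε h = 1` for `h` in `G`, and `ε x_i = 0`. -/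
noncomputable def counitHom : D.Boson →ₐ[k] k :=
  D.lift (fun _ => 1) (fun _ => 0) rfl (by simp) (fun i => zero_pow (D.m_ne_zero i))
    (by simp) (by simp)

theorem comulHom_grp (h : G) : D.comulHom (D.grp h) = D.grp h ⊗ₜ[k] D.grp h := by
  unfold comulHom; rw [lift_grp]

theorem comulHom_x (i : Fin θ) :
    D.comulHom (D.x i) = D.grp (D.g i) ⊗ₜ[k] D.x i + D.x i ⊗ₜ[k] 1 := by
  unfold comulHom; rw [lift_x]

theorem counitHom_grp (h : G) : D.counitHom (D.grp h) = 1 := by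
  unfold counitHom; rw [lift_grp]

theorem counitHom_x (i : Fin θ) : D.counitHom (D.x i) = 0 := by
  unfold counitHom; rw [lift_x]

noncomputable instance instBialgebra : Bialgebra k D.Boson :=
  Bialgebra.ofAlgHom D.comulHom D.counitHom
    (algHom_ext (by intro h; simp [comulHom_grp])
      (by
        intro i
        simp [comulHom_grp, comulHom_x, TensorProduct.add_tmul, TensorProduct.tmul_add,
          Algebra.TensorProduct.one_def, add_assoc]))
    (algHom_ext (by intro h; simp [comulHom_grp, counitHom_grp])
      (by intro i; simp [comulHom_x, counitHom_grp, counitHom_x]))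
    (algHom_ext (by intro h; simp [comulHom_grp, counitHom_grp])
      (by intro i; simp [comulHom_x, counitHom_x]))

theorem comul_eq (b : D.Boson) : Coalgebra.comul (R := k) b = D.comulHom b := rfl

theorem counit_eq (b : D.Boson) : Coalgebra.counit (R := k) b = D.counitHom b := rfl

theorem grp_inv_mul (h : G) : D.grp h⁻¹ * D.grp h = 1 := by
  rw [← grp_mul, inv_mul_cancel, grp_one]

theorem grp_mul_inv (h : G) : D.grp h * D.grp h⁻¹ = 1 := by
  rw [← grp_mul, mul_inv_cancel, grp_one]

theorem grp_inv_x_pow (i : Fin θ) (n : ℕ) :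
    ∃ c : k, (-(D.grp (D.g i)⁻¹ * D.x i)) ^ n = c • (D.grp ((D.g i)⁻¹ ^ n) * D.x i ^ n) := by
  induction n with
  | zero => exact ⟨1, by simp [grp_one]⟩
  | succ n ih =>
    obtain ⟨c, hc⟩ := ih
    have hx : ∀ n : ℕ, ∃ d : k, D.x i ^ n * D.grp (D.g i)⁻¹ =
        d • (D.grp (D.g i)⁻¹ * D.x i ^ n) := by
      have e1 : D.x i * D.grp (D.g i)⁻¹ =
          (D.χ i (D.g i) : k) • (D.grp (D.g i)⁻¹ * D.x i) := by
        rw [grp_mul_x, smul_smul, map_inv]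
        simp
      intro n
      induction n with
      | zero => exact ⟨1, by simp⟩
      | succ n ih =>
        obtain ⟨d, hd⟩ := ih
        exact ⟨(D.χ i (D.g i) : k) * d, by
          rw [pow_succ, mul_assoc, e1, mul_smul_comm, ← mul_assoc, hd, smul_mul_assoc,
            smul_smul, mul_assoc]⟩
    obtain ⟨d, hd⟩ := hx n
    refine ⟨-(c * d), ?_⟩
    rw [pow_succ, hc, mul_neg, smul_mul_assoc, mul_assoc, ← mul_assoc (D.x i ^ n), hd,
      smul_mul_assoc, mul_smul_comm, smul_smul, neg_smul, pow_succ (D.g i)⁻¹, grp_mul, pow_succ]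
    simp only [mul_assoc]

/-- The antipode as an anti-homomorphism: `S h = h⁻¹` for `h` in `G`, and
`S x_i = - g_i⁻¹ x_i`. -/
noncomputable def antipodeHom : D.Boson →ₐ[k] D.Bosonᵐᵒᵖ :=
  D.lift (fun h => MulOpposite.op (D.grp h⁻¹))
    (fun i => MulOpposite.op (-(D.grp (D.g i)⁻¹ * D.x i)))
    (by simp [grp_one])
    (by intro a b; rw [← MulOpposite.op_mul, ← grp_mul, mul_inv_rev])
    (by
      intro i
      obtain ⟨c, hc⟩ := D.grp_inv_x_pow i (D.m i)
      rw [← MulOpposite.op_pow, hc, x_pow]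
      simp)
    (by
      intro i j hij
      have c1 := D.chi_mul_chi i j hij
      have e : ∀ i j : Fin θ, D.x i * D.grp (D.g j)⁻¹ =
          (D.χ i (D.g j) : k) • (D.grp (D.g j)⁻¹ * D.x i) := by
        intro i j
        rw [grp_mul_x, smul_smul, map_inv]
        simp
      have f : ∀ i j : Fin θ, (D.grp (D.g i)⁻¹ * D.x i) * (D.grp (D.g j)⁻¹ * D.x j) =
          (D.χ i (D.g j) : k) • (D.grp ((D.g i)⁻¹ * (D.g j)⁻¹) * (D.x i * D.x j)) := by
        intro i j
        rw [mul_assoc, ← mul_assoc (D.x i), e, smul_mul_assoc, mul_smul_comm, grp_mul]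
        simp only [mul_assoc]
      rw [← MulOpposite.op_mul, ← MulOpposite.op_mul, ← MulOpposite.op_smul]
      congr 1
      rw [neg_mul_neg, neg_mul_neg, f, f, D.x_mul_x i j hij, mul_smul_comm, smul_smul, smul_smul,
        mul_comm (D.g i)⁻¹, mul_assoc, c1, mul_one])
    (by
      intro h i
      rw [← MulOpposite.op_mul, ← MulOpposite.op_mul, ← MulOpposite.op_smul]
      congr 1
      have e : D.x i * D.grp h⁻¹ = (D.χ i h : k) • (D.grp h⁻¹ * D.x i) := by
        rw [grp_mul_x, smul_smul, map_inv]
        simp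
      rw [neg_mul, mul_assoc, e, mul_smul_comm, ← mul_assoc, ← grp_mul, mul_neg, ← mul_assoc,
        ← grp_mul, mul_comm h⁻¹, smul_neg])

/-- The antipode as a linear map. -/
noncomputable def antipodeMap : D.Boson →ₗ[k] D.Boson :=
  (MulOpposite.opLinearEquiv k).symm.toLinearMap ∘ₗ D.antipodeHom.toLinearMap

theorem antipodeMap_apply (b : D.Boson) :
    D.antipodeMap b = MulOpposite.unop (D.antipodeHom b) := rfl

theorem antipodeMap_mul (a b : D.Boson) :
    D.antipodeMap (a * b) = D.antipodeMap b * D.antipodeMap a := by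
  simp [antipodeMap_apply]

theorem antipodeMap_one : D.antipodeMap 1 = 1 := by
  simp [antipodeMap_apply]

theorem antipodeMap_grp (h : G) : D.antipodeMap (D.grp h) = D.grp h⁻¹ := by
  rw [antipodeMap_apply, antipodeHom, lift_grp, MulOpposite.unop_op]

theorem antipodeMap_x (i : Fin θ) : D.antipodeMap (D.x i) = -(D.grp (D.g i)⁻¹ * D.x i) := by
  rw [antipodeMap_apply, antipodeHom, lift_x, MulOpposite.unop_op]

theorem antipode_left_mul (b : D.Boson) (e : D.Boson) (c : k)
    (t : D.Boson ⊗[k] D.Boson)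
    (ht : LinearMap.mul' k D.Boson (D.antipodeMap.rTensor D.Boson t) = algebraMap k D.Boson c)
    (he : LinearMap.mul' k D.Boson (D.antipodeMap.rTensor D.Boson (D.comulHom b)) = e) :
    LinearMap.mul' k D.Boson (D.antipodeMap.rTensor D.Boson (t * D.comulHom b)) = c • e := by
  rw [← he]
  generalize D.comulHom b = s
  induction s using TensorProduct.induction_on with
  | zero => simp
  | add s1 s2 h1 h2 => rw [mul_add, map_add, map_add, h1, h2, map_add, map_add, smul_add]
  | tmul u v =>
    have key : LinearMap.mul' k D.Boson (D.antipodeMap.rTensor D.Boson (t * u ⊗ₜ[k] v)) =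
        D.antipodeMap u *
          LinearMap.mul' k D.Boson (D.antipodeMap.rTensor D.Boson t) * v := by
      clear ht
      induction t using TensorProduct.induction_on with
      | zero => simp
      | add s1 s2 h1 h2 => rw [add_mul, map_add, map_add, h1, h2, map_add, map_add, mul_add, add_mul]
      | tmul a b => simp [antipodeMap_mul, mul_assoc]
    rw [key, ht]
    simp [Algebra.algebraMap_eq_smul_one]

theorem antipode_right_mul (a : D.Boson) (e : D.Boson) (c : k)
    (t : D.Boson ⊗[k] D.Boson)
    (ht : LinearMap.mul' k D.Boson (D.antipodeMap.lTensor D.Boson t) = algebraMap k D.Boson c)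
    (he : LinearMap.mul' k D.Boson (D.antipodeMap.lTensor D.Boson (D.comulHom a)) = e) :
    LinearMap.mul' k D.Boson (D.antipodeMap.lTensor D.Boson (D.comulHom a * t)) = c • e := by
  rw [← he]
  generalize D.comulHom a = s
  induction s using TensorProduct.induction_on with
  | zero => simp
  | add s1 s2 h1 h2 => rw [add_mul, map_add, map_add, h1, h2, map_add, map_add, smul_add]
  | tmul u v =>
    have key : LinearMap.mul' k D.Boson (D.antipodeMap.lTensor D.Boson (u ⊗ₜ[k] v * t)) =
        u * LinearMap.mul' k D.Boson (D.antipodeMap.lTensor D.Boson t) * D.antipodeMap v := by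
      clear ht
      induction t using TensorProduct.induction_on with
      | zero => simp
      | add s1 s2 h1 h2 => rw [mul_add, map_add, map_add, h1, h2, map_add, map_add, mul_add, add_mul]
      | tmul a b => simp [antipodeMap_mul, mul_assoc]
    rw [key, ht]
    simp [Algebra.algebraMap_eq_smul_one]

noncomputable instance instHopfAlgebra : HopfAlgebra k D.Boson where
  antipode := D.antipodeMap
  mul_antipode_rTensor_comul := by
    ext b
    change LinearMap.mul' k D.Boson (D.antipodeMap.rTensor D.Boson (D.comulHom b)) =
      algebraMap k D.Boson (D.counitHom b)
    induction b using induction with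
    | hs c => simp [Algebra.algebraMap_eq_smul_one, Algebra.TensorProduct.one_def, antipodeMap_one]
    | hg h => simp [comulHom_grp, counitHom_grp, antipodeMap_grp, grp_inv_mul]
    | hx i => simp [comulHom_x, counitHom_x, antipodeMap_grp, antipodeMap_x]
    | hm a b iha ihb =>
      rw [map_mul, D.antipode_left_mul b _ _ _ iha ihb, map_mul, map_mul, Algebra.smul_def]
    | ha a b iha ihb => rw [map_add, map_add, map_add, iha, ihb, map_add, map_add]
  mul_antipode_lTensor_comul := by
    ext b
    change LinearMap.mul' k D.Boson (D.antipodeMap.lTensor D.Boson (D.comulHom b)) =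
      algebraMap k D.Boson (D.counitHom b)
    induction b using induction with
    | hs c => simp [Algebra.algebraMap_eq_smul_one, Algebra.TensorProduct.one_def, antipodeMap_one]
    | hg h => simp [comulHom_grp, counitHom_grp, antipodeMap_grp, grp_mul_inv]
    | hx i =>
      simp only [comulHom_x, counitHom_x, map_add, LinearMap.lTensor_tmul, antipodeMap_x,
        antipodeMap_one, LinearMap.mul'_apply, mul_neg, ← mul_assoc, grp_mul_inv, one_mul, mul_one,
        map_zero, neg_add_cancel]
    | hm a b iha ihb =>
      rw [map_mul, D.antipode_right_mul a _ _ _ ihb iha, map_mul, map_mul, Algebra.smul_def,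
        Algebra.commutes]
    | ha a b iha ihb => rw [map_add, map_add, map_add, iha, ihb, map_add, map_add]

end Relations

end QLSDatum

/-! ### Actions of Hopf algebras -/

/-- An action of the Hopf algebra `H` on the algebra `A`: a left `H`-module structure on the
`k`-vector space `A` (an algebra homomorphism to the linear endomorphisms of `A`) with
`h · 1 = ε(h) 1` and `h · (a b) = ∑ (h₁ · a) (h₂ · b)`. -/
structure HopfAction (k H A : Type*) [Field k] [Ring H] [HopfAlgebra k H] [Ring A]
    [Algebra k A] where
  act : H →ₐ[k] Module.End k A
  act_one : ∀ h : H, act h 1 = algebraMap k A (Coalgebra.counit h)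
  act_mul : ∀ (h : H) (a b : A), act h (a * b) =
    LinearMap.mul' k A (TensorProduct.map (act.toLinearMap.flip a) (act.toLinearMap.flip b)
      (Coalgebra.comul h))

/-! ### Quantum matrix algebras -/

/-- The defining relations of the single parameter quantum matrix algebra. -/
inductive QMatRel {k : Type*} [Field k] (N : ℕ) (q : kˣ) :
    FreeAlgebra k (Fin N × Fin N) → FreeAlgebra k (Fin N × Fin N) → Prop
  | col (i l j : Fin N) (h : i < l) :
      QMatRel N q (FreeAlgebra.ι k (i, j) * FreeAlgebra.ι k (l, j))
        ((q : k) • (FreeAlgebra.ι k (l, j) * FreeAlgebra.ι k (i, j)))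
  | row (i j m : Fin N) (h : j < m) :
      QMatRel N q (FreeAlgebra.ι k (i, j) * FreeAlgebra.ι k (i, m))
        ((q : k) • (FreeAlgebra.ι k (i, m) * FreeAlgebra.ι k (i, j)))
  | anti (i l j m : Fin N) (h : i < l) (h' : m < j) :
      QMatRel N q (FreeAlgebra.ι k (i, j) * FreeAlgebra.ι k (l, m))
        (FreeAlgebra.ι k (l, m) * FreeAlgebra.ι k (i, j))
  | diag (i l j m : Fin N) (h : i < l) (h' : j < m) :
      QMatRel N q (FreeAlgebra.ι k (i, j) * FreeAlgebra.ι k (l, m))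
        (FreeAlgebra.ι k (l, m) * FreeAlgebra.ι k (i, j) +
          ((q : k) - (q : k)⁻¹) • (FreeAlgebra.ι k (i, m) * FreeAlgebra.ι k (l, j)))

/-- The quantum matrix algebra `O_q(M_N(k))`. -/
def QMat {k : Type*} [Field k] (N : ℕ) (q : kˣ) : Type _ := RingQuot (QMatRel N q)

namespace QMat

noncomputable instance {k : Type*} [Field k] (N : ℕ) (q : kˣ) : Ring (QMat N q) :=
  inferInstanceAs (Ring (RingQuot (QMatRel N q)))

noncomputable instance {k : Type*} [Field k] (N : ℕ) (q : kˣ) : Algebra k (QMat N q) :=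
  inferInstanceAs (Algebra k (RingQuot (QMatRel N q)))

/-- The generators `Y_ij`. -/
noncomputable def Y {k : Type*} [Field k] {N : ℕ} (q : kˣ) (i j : Fin N) : QMat N q :=
  RingQuot.mkAlgHom k (QMatRel N q) (FreeAlgebra.ι k (i, j))

section

variable {k : Type*} [Field k] {N : ℕ} (q : kˣ)

theorem Y_col (i l j : Fin N) (h : i < l) : Y q i j * Y q l j = (q : k) • (Y q l j * Y q i j) := by
  have e := RingQuot.mkAlgHom_rel k (QMatRel.col (q := q) i l j h)
  rwa [map_mul, map_smul, map_mul] at e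

theorem Y_row (i j m : Fin N) (h : j < m) : Y q i j * Y q i m = (q : k) • (Y q i m * Y q i j) := by
  have e := RingQuot.mkAlgHom_rel k (QMatRel.row (q := q) i j m h)
  rwa [map_mul, map_smul, map_mul] at e

theorem Y_anti (i l j m : Fin N) (h : i < l) (h' : m < j) :
    Y q i j * Y q l m = Y q l m * Y q i j := by
  have e := RingQuot.mkAlgHom_rel k (QMatRel.anti (q := q) i l j m h h')
  rwa [map_mul, map_mul] at e

theorem Y_diag (i l j m : Fin N) (h : i < l) (h' : j < m) :
    Y q i j * Y q l m =
      Y q l m * Y q i j + ((q : k) - (q : k)⁻¹) • (Y q i m * Y q l j) := by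
  have e := RingQuot.mkAlgHom_rel k (QMatRel.diag (q := q) i l j m h h')
  rwa [map_mul, map_add, map_smul, map_mul, map_mul] at e

/-- The universal property of the presentation. -/
noncomputable def lift {R : Type*} [Ring R] [Algebra k R] (y : Fin N → Fin N → R)
    (h1 : ∀ i l j, i < l → y i j * y l j = (q : k) • (y l j * y i j))
    (h2 : ∀ i j m, j < m → y i j * y i m = (q : k) • (y i m * y i j))
    (h3 : ∀ i l j m, i < l → m < j → y i j * y l m = y l m * y i j)
    (h4 : ∀ i l j m, i < l → j < m → y i j * y l m =
      y l m * y i j + ((q : k) - (q : k)⁻¹) • (y i m * y l j)) : QMat N q →ₐ[k] R :=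
  RingQuot.liftAlgHom k ⟨FreeAlgebra.lift k (fun p : Fin N × Fin N => y p.1 p.2), by
    intro a b hab
    cases hab with
    | col i l j h => simpa using h1 i l j h
    | row i j m h => simpa using h2 i j m h
    | anti i l j m h h' => simpa using h3 i l j m h h'
    | diag i l j m h h' => simpa using h4 i l j m h h'⟩

theorem lift_Y {R : Type*} [Ring R] [Algebra k R] (y : Fin N → Fin N → R)
    (h1 : ∀ i l j, i < l → y i j * y l j = (q : k) • (y l j * y i j))
    (h2 : ∀ i j m, j < m → y i j * y i m = (q : k) • (y i m * y i j))
    (h3 : ∀ i l j m, i < l → m < j → y i j * y l m = y l m * y i j)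
    (h4 : ∀ i l j m, i < l → j < m → y i j * y l m =
      y l m * y i j + ((q : k) - (q : k)⁻¹) • (y i m * y l j)) (i j : Fin N) :
    lift q y h1 h2 h3 h4 (Y q i j) = y i j := by
  have e : lift q y h1 h2 h3 h4 (Y q i j) =
      FreeAlgebra.lift k (fun p : Fin N × Fin N => y p.1 p.2) (FreeAlgebra.ι k (i, j)) :=
    RingQuot.liftAlgHom_mkAlgHom_apply k _ _ _
  rw [e, FreeAlgebra.lift_ι_apply]

variable {q} in
theorem algHom_ext {R : Type*} [Ring R] [Algebra k R] {φ ψ : QMat N q →ₐ[k] R}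
    (h : ∀ i j, φ (Y q i j) = ψ (Y q i j)) : φ = ψ := by
  refine RingQuot.ringQuot_ext' (S := k) (s := QMatRel N q) φ ψ (FreeAlgebra.hom_ext ?_)
  funext p
  exact h p.1 p.2

/-- The degree one component: the span of the generators. -/
noncomputable def degreeOne (N : ℕ) : Submodule k (QMat N q) :=
  Submodule.span k (Set.range fun p : Fin N × Fin N => Y q p.1 p.2)

/-- The endomorphism `Y_ij ↦ a_i b_j Y_ij`. -/
noncomputable def torusHom (a b : Fin N → kˣ) : QMat N q →ₐ[k] QMat N q :=
  lift q (fun i j => ((a i : k) * (b j : k)) • Y q i j)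
    (by
      intro i l j h
      simp only [smul_mul_smul_comm, Y_col q i l j h, smul_smul]
      congr 1; ring)
    (by
      intro i j m h
      simp only [smul_mul_smul_comm, Y_row q i j m h, smul_smul]
      congr 1; ring)
    (by
      intro i l j m h h'
      simp only [smul_mul_smul_comm, Y_anti q i l j m h h']
      congr 1; ring)
    (by
      intro i l j m h h'
      simp only [smul_mul_smul_comm, Y_diag q i l j m h h', smul_smul, smul_add]
      congr 2 <;> ring)

theorem torusHom_Y (a b : Fin N → kˣ) (i j : Fin N) :
    torusHom q a b (Y q i j) = ((a i : k) * (b j : k)) • Y q i j := by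
  unfold torusHom; rw [lift_Y]

theorem torus_scalar (c d : kˣ) : (c : k) * (d : k) * ((c : k)⁻¹ * (d : k)⁻¹) = 1 := by
  have hc := c.ne_zero
  have hd := d.ne_zero
  field_simp

/-- The automorphism `Y_ij ↦ a_i b_j Y_ij`. -/
noncomputable def torusAut (a b : Fin N → kˣ) : QMat N q ≃ₐ[k] QMat N q :=
  AlgEquiv.ofAlgHom (torusHom q a b) (torusHom q a⁻¹ b⁻¹)
    (algHom_ext fun i j => by
      simp only [AlgHom.comp_apply, torusHom_Y, map_smul, smul_smul, Pi.inv_apply,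
        Units.val_inv_eq_inv_val, AlgHom.id_apply]
      rw [mul_comm, torus_scalar, one_smul])
    (algHom_ext fun i j => by
      simp only [AlgHom.comp_apply, torusHom_Y, map_smul, smul_smul, Pi.inv_apply,
        Units.val_inv_eq_inv_val, AlgHom.id_apply]
      rw [torus_scalar, one_smul])

theorem torusAut_Y (a b : Fin N → kˣ) (i j : Fin N) :
    torusAut q a b (Y q i j) = ((a i : k) * (b j : k)) • Y q i j := torusHom_Y q a b i j

/-- The transposition endomorphism `Y_ij ↦ Y_ji`. -/
noncomputable def transposeHom (N : ℕ) : QMat N q →ₐ[k] QMat N q :=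
  lift q (fun i j => Y q j i)
    (fun i l j h => Y_row q j i l h)
    (fun i j m h => Y_col q j m i h)
    (fun i l j m h h' => (Y_anti q m j l i h' h).symm)
    (fun i l j m h h' => by rw [Y_diag q j m i l h' h, Y_anti q j m l i h' h])

theorem transposeHom_Y (i j : Fin N) : transposeHom q N (Y q i j) = Y q j i := by
  unfold transposeHom; rw [lift_Y]

/-- The transposition automorphism `τ : Y_ij ↦ Y_ji`. -/
noncomputable def transposeAut (N : ℕ) : QMat N q ≃ₐ[k] QMat N q :=
  AlgEquiv.ofAlgHom (transposeHom q N) (transposeHom q N)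
    (algHom_ext fun i j => by simp [transposeHom_Y])
    (algHom_ext fun i j => by simp [transposeHom_Y])

theorem transposeAut_Y (i j : Fin N) : transposeAut q N (Y q i j) = Y q j i :=
  transposeHom_Y q i j

/-- The torus of automorphisms `Y_ij ↦ a_i b_j Y_ij`, with the last `b_j` normalized to `1`: a
copy of `(kˣ)^(2 N - 1)`. -/
noncomputable def torus (N : ℕ) : Set (QMat N q ≃ₐ[k] QMat N q) :=
  {φ | ∃ a b : Fin N → kˣ, (∀ j : Fin N, (j : ℕ) + 1 = N → b j = 1) ∧ φ = torusAut q a b}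

/-- The subgroup `(kˣ)^(2 N - 1) ⋊ ⟨τ⟩` of the automorphism group, generated by the torus and by
the transposition `τ`. -/
noncomputable def torusTranspose (N : ℕ) : Subgroup (QMat N q ≃ₐ[k] QMat N q) :=
  Subgroup.closure (torus q N ∪ {transposeAut q N})

end

end QMat

/-! Each `x_i` acts as a skew derivation, X(ab) = g(a) X(b) + X(a) b, that is linear on the
generators, and each `g_i` acts monomially, scaling the generators by factors `s` and possibly
transposing their indices. Applying X to the quadratic relations and comparing coefficients in
degree two gives equations between the matrix `c` of X on generators and the scalars `s`. Everything
is extracted from these equations; throughout, ν = q - q⁻¹ ≠ 0.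

Twists involving τ are excluded (`not_swap`). Commuting X past g twice shows that c p b = 0 whenever
g² has the same eigenvalue on Y_p and Y_b, because χ_i(g_i)² ≠ 1 (this is m_i ≠ 2). So c p p and c p
p.swap vanish, and the relations with the upper right corner generator, which q-commutes with all
the others, then spread the vanishing to nearly all of `c`; a relation along one line settles the
rest.

For diagonal twists, an entry of `c` cannot change both indices (`mixed_eq_zero`), nor neither
(`apply_self`). An entry changing only the row (`down_arrow`, `up_arrow`) either belongs to an
operation between adjacent rows, whose twist is q on the upper row, q⁻¹ on the lower one and 1
elsewhere, or is one of the exceptional entries Y_11 ↦ Y_N1 and Y_NN ↦ Y_1N. Columns follow by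
transposition. An exceptional twist multiplies by q² from the first column to the second, or from
the last but one to the last, so it can be charged to that pair of columns. Hence every x_i is
charged to one of the N - 1 pairs of adjacent rows or the N - 1 pairs of adjacent columns.

No pair is charged twice (`Attached.unique`). A nonzero entry p → b of x_i forces χ_i(g_j) = s_j(b)
/ s_j(p). For two operations charged to the same pair, χ_i(g_j) χ_j(g_i) computed this way is q^{±2}
or q^{±4}, which differs from 1 because χ_i(g_i) = q^{±2} and χ_i(g_i)² ≠ 1. The one remaining case,
two opposite operations on one pair, contradicts the q-commutation of x_i and x_j (`not_down_up`).
This gives θ ≤ 2 (N - 1). -/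

set_option linter.unusedSimpArgs false

/-! ### Coefficients of quadratic relations, and skew derivations -/

namespace QMat

variable {k : Type*} [Field k] {N : ℕ} {q : kˣ}

/-- The generators, indexed by pairs. -/
noncomputable def gen (q : kˣ) (p : Fin N × Fin N) : QMat N q := Y q p.1 p.2

/-- The module `k × V × k` through which a bilinear form on the generators is read off. -/
abbrev Trunc (k : Type*) (N : ℕ) : Type _ := k × (Fin N × Fin N → k) × k

/-- Left multiplication by a generator, with products of two generators evaluated by `B`. -/
def truncMul (B : Fin N × Fin N → Fin N × Fin N → k) (p : Fin N × Fin N) :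
    Module.End k (Trunc k N) where
  toFun x := (0, x.1 • Pi.single p 1, ∑ r, x.2.1 r * B p r)
  map_add' x y := by
    ext <;> simp [add_mul, Finset.sum_add_distrib]
  map_smul' c x := by
    ext <;> simp [mul_assoc, Finset.mul_sum]

theorem truncMul_mul (B : Fin N × Fin N → Fin N × Fin N → k) (p r : Fin N × Fin N)
    (x : Trunc k N) : (truncMul B p * truncMul B r) x = (0, 0, x.1 * B p r) := by
  ext <;> simp [truncMul, Pi.single_apply]

/-- A bilinear form on the generators is compatible with the defining relations. -/
structure IsCompatible (q : kˣ) (B : Fin N × Fin N → Fin N × Fin N → k) : Prop where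
  col : ∀ i l j, i < l → B (i, j) (l, j) = q * B (l, j) (i, j)
  row : ∀ i j m, j < m → B (i, j) (i, m) = q * B (i, m) (i, j)
  anti : ∀ i l j m, i < l → m < j → B (i, j) (l, m) = B (l, m) (i, j)
  diag : ∀ i l j m, i < l → j < m →
    B (i, j) (l, m) = B (l, m) (i, j) + ((q : k) - (q : k)⁻¹) * B (i, m) (l, j)

/-- The representation on `k × V × k` attached to a compatible bilinear form. -/
noncomputable def truncRep {B : Fin N × Fin N → Fin N × Fin N → k} (hB : IsCompatible q B) :
    QMat N q →ₐ[k] Module.End k (Trunc k N) :=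
  lift q (fun i j => truncMul B (i, j))
    (by
      intro i l j h
      refine LinearMap.ext fun x => ?_
      rw [LinearMap.smul_apply, truncMul_mul, truncMul_mul, hB.col i l j h]
      ext <;> simp [mul_left_comm])
    (by
      intro i j m h
      refine LinearMap.ext fun x => ?_
      rw [LinearMap.smul_apply, truncMul_mul, truncMul_mul, hB.row i j m h]
      ext <;> simp [mul_left_comm])
    (by
      intro i l j m h h'
      refine LinearMap.ext fun x => ?_
      rw [truncMul_mul, truncMul_mul, hB.anti i l j m h h'])
    (by
      intro i l j m h h'
      refine LinearMap.ext fun x => ?_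
      rw [LinearMap.add_apply, LinearMap.smul_apply, truncMul_mul, truncMul_mul, truncMul_mul,
        hB.diag i l j m h h']
      ext <;> simp [mul_left_comm, mul_add])

theorem truncRep_gen {B : Fin N × Fin N → Fin N × Fin N → k} (hB : IsCompatible q B)
    (p : Fin N × Fin N) : truncRep hB (gen q p) = truncMul B p := by
  unfold truncRep gen; rw [lift_Y]

/-- With the zero form, Y_p sends the vector (1, 0, 0) to the basis vector e_p of the middle factor,
which separates the generators. -/
theorem linearIndependent_gen : LinearIndependent k (gen q : Fin N × Fin N → QMat N q) := by
  have hB : IsCompatible q (fun _ _ : Fin N × Fin N => (0 : k)) := by constructor <;> simp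
  let f : QMat N q →ₗ[k] (Fin N × Fin N → k) :=
    LinearMap.fst k _ _ ∘ₗ LinearMap.snd k _ _ ∘ₗ
      LinearMap.applyₗ ((1, 0, 0) : Trunc k N) ∘ₗ (truncRep hB).toLinearMap
  refine LinearIndependent.of_comp f ?_
  have : (f ∘ gen q : Fin N × Fin N → (Fin N × Fin N → k)) = fun p => Pi.single p 1 := by
    funext p
    simp [f, truncRep_gen, truncMul]
  rw [this]
  exact Pi.linearIndependent_single_one _ _

/-- `C` is the coefficient matrix of a quadratic relation between the generators. -/
def QuadZero (q : kˣ) (C : Fin N × Fin N → Fin N × Fin N → k) : Prop :=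
  ∑ a, ∑ b, C a b • (gen q a * gen q b) = 0

/-- Y_a Y_b sends (1, 0, 0) to (0, 0, B a b), so a compatible form is a well defined functional on
degree two. This replaces a PBW basis. -/
theorem QuadZero.sum_eq_zero {C B : Fin N × Fin N → Fin N × Fin N → k} (hC : QuadZero q C)
    (hB : IsCompatible q B) : ∑ a, ∑ b, C a b * B a b = 0 := by
  have h := congrArg (fun y => (truncRep hB y ((1, 0, 0) : Trunc k N)).2.2) hC
  simpa [map_sum, truncRep_gen, truncMul, Prod.snd_sum, LinearMap.sum_apply,
    Pi.single_apply] using h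

/-- This form and the next four are the functionals dual to the ordered monomials Y_p², Y_lj Y_ij,
Y_im Y_ij, Y_lm Y_ij and Y_lj Y_im (i < l, j < m). Each takes on the opposite order the value
dictated by the relations; in the last one Y_ij Y_lm contributes ν. -/
theorem isCompatible_sq (p : Fin N × Fin N) :
    IsCompatible q (fun a b => if a = p ∧ b = p then 1 else 0) := by
  constructor <;> grind

theorem isCompatible_col {i l : Fin N} (j : Fin N) (h : i < l) :
    IsCompatible q (fun a b => (if a = (l, j) ∧ b = (i, j) then 1 else 0) +
      (if a = (i, j) ∧ b = (l, j) then (q : k) else 0)) := by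
  constructor <;> grind

theorem isCompatible_row (i : Fin N) {j m : Fin N} (h : j < m) :
    IsCompatible q (fun a b => (if a = (i, m) ∧ b = (i, j) then 1 else 0) +
      (if a = (i, j) ∧ b = (i, m) then (q : k) else 0)) := by
  constructor <;> grind

theorem isCompatible_diag {i l j m : Fin N} (h : i < l) (h' : j < m) :
    IsCompatible q (fun a b => (if a = (l, m) ∧ b = (i, j) then 1 else 0) +
      (if a = (i, j) ∧ b = (l, m) then (1 : k) else 0)) := by
  constructor <;> grind

theorem isCompatible_anti {i l j m : Fin N} (h : i < l) (h' : j < m) :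
    IsCompatible q (fun a b => (if a = (l, j) ∧ b = (i, m) then 1 else 0) +
      (if a = (i, m) ∧ b = (l, j) then (1 : k) else 0) +
      (if a = (i, j) ∧ b = (l, m) then (q : k) - (q : k)⁻¹ else 0)) := by
  constructor
  -- The diagonal relation holds identically in ν, which is therefore kept as an atom.
  case diag => generalize (q : k) - (q : k)⁻¹ = ν; grind (splits := 20)
  all_goals grind

namespace QuadZero

variable {C : Fin N × Fin N → Fin N × Fin N → k}

theorem sum_mul_ite (C : Fin N × Fin N → Fin N × Fin N → k) (p r : Fin N × Fin N) (x : k) :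
    ∑ a, ∑ b, C a b * (if a = p ∧ b = r then x else 0) = C p r * x := by
  simp [ite_and]

theorem sq (hC : QuadZero q C) (p : Fin N × Fin N) : C p p = 0 := by
  simpa only [sum_mul_ite, mul_one] using hC.sum_eq_zero (isCompatible_sq p)

theorem col (hC : QuadZero q C) {i l : Fin N} (j : Fin N) (h : i < l) :
    C (l, j) (i, j) + C (i, j) (l, j) * q = 0 := by
  simpa only [mul_add, Finset.sum_add_distrib, sum_mul_ite, mul_one] using
    hC.sum_eq_zero (isCompatible_col j h)

theorem row (hC : QuadZero q C) (i : Fin N) {j m : Fin N} (h : j < m) :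
    C (i, m) (i, j) + C (i, j) (i, m) * q = 0 := by
  simpa only [mul_add, Finset.sum_add_distrib, sum_mul_ite, mul_one] using
    hC.sum_eq_zero (isCompatible_row i h)

theorem diag (hC : QuadZero q C) {i l j m : Fin N} (h : i < l) (h' : j < m) :
    C (l, m) (i, j) + C (i, j) (l, m) = 0 := by
  simpa only [mul_add, Finset.sum_add_distrib, sum_mul_ite, mul_one] using
    hC.sum_eq_zero (isCompatible_diag h h')

theorem anti (hC : QuadZero q C) {i l j m : Fin N} (h : i < l) (h' : j < m) :
    C (l, j) (i, m) + C (i, m) (l, j) + C (i, j) (l, m) * ((q : k) - (q : k)⁻¹) = 0 := by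
  simpa only [mul_add, Finset.sum_add_distrib, sum_mul_ite, mul_one] using
    hC.sum_eq_zero (isCompatible_anti h h')

/-- A coefficient vanishes if all the other coefficients of the same multidegree do. -/
theorem eq_zero_of (hC : QuadZero q C) (a b : Fin N × Fin N) (h1 : a ≠ b → C b a = 0)
    (h2 : ∀ i l j m, i < l → j < m →
      (a = (l, j) ∧ b = (i, m)) ∨ (a = (i, m) ∧ b = (l, j)) → C (i, j) (l, m) = 0) :
    C a b = 0 := by
  obtain ⟨i, j⟩ := a
  obtain ⟨l, m⟩ := b
  have hq := q.ne_zero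
  rcases lt_trichotomy i l with hi | rfl | hi <;> rcases lt_trichotomy j m with hj | rfl | hj
  · simpa [h1 (by simp [hi.ne])] using hC.diag hi hj
  · simpa [h1 (by simp [hi.ne])] using hC.col j hi
  · simpa [h1 (by simp [hi.ne]), h2 i l m j hi hj (by simp)] using hC.anti hi hj
  · simpa [h1 (by simp [hj.ne])] using hC.row i hj
  · exact hC.sq _
  · simpa [h1 (by simp [hj.ne'])] using hC.row i hj
  · simpa [h1 (by simp [hi.ne']), h2 l i j m hi hj (by simp)] using hC.anti hi hj
  · simpa [h1 (by simp [hi.ne'])] using hC.col j hi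
  · simpa [h1 (by simp [hi.ne'])] using hC.diag hi hj

end QuadZero

/-- The coefficients of `X (gen u * gen v)` for a skew derivation `X` with coefficient matrix `c`
and twist `gen p ↦ s p • gen (π p)`. -/
def skewCoeff (π : Fin N × Fin N → Fin N × Fin N) (s : Fin N × Fin N → k)
    (c : Fin N × Fin N → Fin N × Fin N → k) (u v a b : Fin N × Fin N) : k :=
  (if a = π u then s u * c v b else 0) + (if b = v then c u a else 0)

/-- `c` is the matrix on generators of a linear skew derivation whose twist is
`gen p ↦ s p • gen (π p)`. -/
def IsSkew (q : kˣ) (π : Fin N × Fin N → Fin N × Fin N) (s : Fin N × Fin N → k)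
    (c : Fin N × Fin N → Fin N × Fin N → k) : Prop :=
  ∃ X : QMat N q →ₗ[k] QMat N q, (∀ p, X (gen q p) = ∑ b, c p b • gen q b) ∧
    ∀ p r, X (gen q p * gen q r) =
      s p • (gen q (π p) * X (gen q r)) + X (gen q p) * gen q r

namespace IsSkew

variable {π : Fin N × Fin N → Fin N × Fin N} {s : Fin N × Fin N → k}
  {c : Fin N × Fin N → Fin N × Fin N → k}

theorem exists_sum (h : IsSkew q π s c) : ∃ X : QMat N q →ₗ[k] QMat N q, ∀ u v,
    X (gen q u * gen q v) = ∑ a, ∑ b, skewCoeff π s c u v a b • (gen q a * gen q b) := by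
  obtain ⟨X, h1, h2⟩ := h
  refine ⟨X, fun u v => ?_⟩
  rw [h2, h1, h1]
  simp [skewCoeff, add_smul, Finset.sum_add_distrib, Finset.mul_sum, Finset.sum_mul,
    Finset.smul_sum, mul_smul, ite_smul]

/-- X applied to a defining relation yields a quadratic relation in the generators. This and the
three lemmas that follow are the only source of equations for `c` and `s`. -/
theorem rel_col (h : IsSkew q π s c) {i l : Fin N} (j : Fin N) (hi : i < l) :
    QuadZero q fun a b => skewCoeff π s c (i, j) (l, j) a b -
      q * skewCoeff π s c (l, j) (i, j) a b := by
  obtain ⟨X, hX⟩ := h.exists_sum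
  have e := congrArg X (Y_col q i l j hi)
  rw [map_smul] at e
  have e' : X (gen q (i, j) * gen q (l, j)) = (q : k) • X (gen q (l, j) * gen q (i, j)) := e
  rw [hX, hX] at e'
  simp only [QuadZero, sub_smul, Finset.sum_sub_distrib, mul_smul, ← Finset.smul_sum]
  rw [e', sub_self]

theorem rel_row (h : IsSkew q π s c) (i : Fin N) {j m : Fin N} (hj : j < m) :
    QuadZero q fun a b => skewCoeff π s c (i, j) (i, m) a b -
      q * skewCoeff π s c (i, m) (i, j) a b := by
  obtain ⟨X, hX⟩ := h.exists_sum
  have e := congrArg X (Y_row q i j m hj)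
  rw [map_smul] at e
  have e' : X (gen q (i, j) * gen q (i, m)) = (q : k) • X (gen q (i, m) * gen q (i, j)) := e
  rw [hX, hX] at e'
  simp only [QuadZero, sub_smul, Finset.sum_sub_distrib, mul_smul, ← Finset.smul_sum]
  rw [e', sub_self]

theorem rel_anti (h : IsSkew q π s c) {i l j m : Fin N} (hi : i < l) (hj : j < m) :
    QuadZero q fun a b => skewCoeff π s c (i, m) (l, j) a b -
      skewCoeff π s c (l, j) (i, m) a b := by
  obtain ⟨X, hX⟩ := h.exists_sum
  have e' : X (gen q (i, m) * gen q (l, j)) = X (gen q (l, j) * gen q (i, m)) :=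
    congrArg X (Y_anti q i l m j hi hj)
  rw [hX, hX] at e'
  simp only [QuadZero, sub_smul, Finset.sum_sub_distrib]
  rw [e', sub_self]

theorem rel_diag (h : IsSkew q π s c) {i l j m : Fin N} (hi : i < l) (hj : j < m) :
    QuadZero q fun a b => skewCoeff π s c (i, j) (l, m) a b -
      skewCoeff π s c (l, m) (i, j) a b -
      ((q : k) - (q : k)⁻¹) * skewCoeff π s c (i, m) (l, j) a b := by
  obtain ⟨X, hX⟩ := h.exists_sum
  have e := congrArg X (Y_diag q i l j m hi hj)
  rw [map_add, map_smul] at e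
  have e' : X (gen q (i, j) * gen q (l, m)) = X (gen q (l, m) * gen q (i, j)) +
    ((q : k) - (q : k)⁻¹) • X (gen q (i, m) * gen q (l, j)) := e
  rw [hX, hX, hX] at e'
  simp only [QuadZero, sub_smul _ _ (_ : QMat N q), Finset.sum_sub_distrib,
    mul_smul _ _ (_ : QMat N q), ← Finset.smul_sum]
  rw [e']
  simp only [sub_smul]
  abel

/-- The transpose of a skew derivation with diagonal twist. -/
theorem transpose (h : IsSkew q id s c) :
    IsSkew q id (fun p => s p.swap) (fun p b => c p.swap b.swap) := by
  obtain ⟨X, h1, h2⟩ := h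
  have ht : ∀ p : Fin N × Fin N, transposeAut q N (gen q p) = gen q p.swap :=
    fun p => transposeAut_Y q p.1 p.2
  let T : QMat N q →ₗ[k] QMat N q := (transposeAut q N).toLinearMap
  have hT : ∀ y, T y = transposeAut q N y := fun _ => rfl
  have hTT : ∀ p : Fin N × Fin N, T (T (gen q p)) = gen q p := by
    intro p; rw [hT, hT, ht, ht, Prod.swap_swap]
  refine ⟨T ∘ₗ X ∘ₗ T, fun p => ?_, fun p r => ?_⟩
  · simp only [LinearMap.comp_apply, hT, ht, h1, map_sum, map_smul]
    exact Fintype.sum_equiv (Equiv.prodComm _ _) _ _ fun b => by simp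
  · simp only [LinearMap.comp_apply, hT, ht, map_mul, h2, map_add, map_smul, id_eq,
      Prod.swap_swap]

end IsSkew

end QMat

/-! ### Diagonal twists: the equations satisfied by the coefficients -/

namespace QMat

variable {k : Type*} [Field k] {N : ℕ} {q : kˣ}

namespace IsSkew

variable {s : Fin N × Fin N → k} {c : Fin N × Fin N → Fin N × Fin N → k}

/-! #### Row operations: the equations for the coefficients `c (i, j) (t, j)` -/

section RowEquations

variable (h : IsSkew q id s c) {i t l j m : Fin N}
include h

/-- From the relation inside the source row i, read on the diagonal and antidiagonal monomials of
rows i and t. -/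
theorem source_lt (hi : i < t) (hj : j < m) :
    s (i, j) * c (i, m) (t, m) = q * c (i, m) (t, m) ∧
    c (i, j) (t, j) - q * (s (i, m) * c (i, j) (t, j)) +
      (s (i, j) * c (i, m) (t, m)) * ((q : k) - (q : k)⁻¹) = 0 := by
  have e1 := (h.rel_row i hj).diag hi hj
  have e2 := (h.rel_row i hj).anti hi hj
  simp only [skewCoeff, id_eq, Prod.mk.injEq, hi.ne, hi.ne', hj.ne, hj.ne', and_true, and_false,
    true_and, false_and, if_true, if_false, add_zero, zero_add, mul_zero, sub_zero] at e1 e2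
  exact ⟨by linear_combination e1, by linear_combination e2⟩

theorem source_gt (hi : t < i) (hj : j < m) :
    c (i, j) (t, j) = q * (s (i, m) * c (i, j) (t, j)) ∧
    s (i, j) * c (i, m) (t, m) - q * c (i, m) (t, m) +
      c (i, j) (t, j) * ((q : k) - (q : k)⁻¹) = 0 := by
  have e1 := (h.rel_row i hj).diag hi hj
  have e2 := (h.rel_row i hj).anti hi hj
  simp only [skewCoeff, id_eq, Prod.mk.injEq, hi.ne, hi.ne', hj.ne, hj.ne', and_true, and_false,
    true_and, false_and, if_true, if_false, add_zero, zero_add, mul_zero, sub_zero] at e1 e2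
  exact ⟨by linear_combination e1, by linear_combination e2⟩

/-- From the column relation of Y_ij and Y_tj: moving row i to row t produces the square Y_tj². -/
theorem target_sq_lt (hi : i < t) (j : Fin N) :
    c (i, j) (t, j) = q * (s (t, j) * c (i, j) (t, j)) := by
  have e1 := (h.rel_col j hi).sq (t, j)
  simp only [skewCoeff, id_eq, Prod.mk.injEq, hi.ne, hi.ne', and_true, and_false,
    true_and, false_and, if_true, if_false, add_zero, zero_add, mul_zero, sub_zero] at e1
  linear_combination e1

theorem target_sq_gt (hi : t < i) (j : Fin N) :
    s (t, j) * c (i, j) (t, j) = q * c (i, j) (t, j) := by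
  have e1 := (h.rel_col j hi).sq (t, j)
  simp only [skewCoeff, id_eq, Prod.mk.injEq, hi.ne, hi.ne', and_true, and_false,
    true_and, false_and, if_true, if_false, add_zero, zero_add, mul_zero, sub_zero] at e1
  linear_combination e1

/-- From the diagonal relation of rows i and t, both of whose factors end in row t. -/
theorem target_lt (hi : i < t) (hj : j < m) :
    q * c (i, j) (t, j) - s (t, m) * c (i, j) (t, j) -
      ((q : k) - (q : k)⁻¹) * c (i, m) (t, m) = 0 := by
  have e1 := (h.rel_diag hi hj).row t hj
  simp only [skewCoeff, id_eq, Prod.mk.injEq, hi.ne, hi.ne', hj.ne, hj.ne', and_true, and_false,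
    true_and, false_and, if_true, if_false, add_zero, zero_add, mul_zero, sub_zero] at e1
  linear_combination e1

theorem target_gt (hi : t < i) (hj : j < m) :
    q * (s (t, j) * c (i, m) (t, m)) - c (i, m) (t, m) -
      ((q : k) - (q : k)⁻¹) * (s (t, m) * c (i, j) (t, j)) = 0 := by
  have e1 := (h.rel_diag hi hj).row t hj
  simp only [skewCoeff, id_eq, Prod.mk.injEq, hi.ne, hi.ne', hj.ne, hj.ne', and_true, and_false,
    true_and, false_and, if_true, if_false, add_zero, zero_add, mul_zero, sub_zero] at e1
  linear_combination e1

/-- Row l lies on the same side of i and of t, so the column relation keeps its shape when i moves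
to t. Comparing the two orders then forces the twist on row l to be trivial wherever `c` is not
zero. -/
theorem bystander_col_below (hl : i < l) (hl' : t < l) (ht : i ≠ t) (j : Fin N) :
    s (l, j) * c (i, j) (t, j) = c (i, j) (t, j) := by
  have e1 := (h.rel_col j hl).col j hl'
  simp only [skewCoeff, id_eq, Prod.mk.injEq, hl.ne, hl.ne', hl'.ne, hl'.ne', ht, ht.symm,
    and_true, and_false,
    true_and, false_and, if_true, if_false, add_zero, zero_add, mul_zero, sub_zero] at e1
  have hq := q.ne_zero
  exact mul_left_cancel₀ hq (by linear_combination -e1)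

theorem bystander_col_above (hl : l < i) (hl' : l < t) (ht : i ≠ t) (j : Fin N) :
    s (l, j) * c (i, j) (t, j) = c (i, j) (t, j) := by
  have e1 := (h.rel_col j hl).col j hl'
  simp only [skewCoeff, id_eq, Prod.mk.injEq, hl.ne, hl.ne', hl'.ne, hl'.ne', ht, ht.symm,
    and_true, and_false,
    true_and, false_and, if_true, if_false, add_zero, zero_add, mul_zero, sub_zero] at e1
  have hq := q.ne_zero
  exact mul_left_cancel₀ hq (by linear_combination e1)

/-- The ν-terms of the diagonal relation with an outside row compare the coefficients in two
different columns. -/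
theorem bystander_below (hl : i < l) (hl' : t < l) (ht : i ≠ t) (hj : j < m) :
    (c (i, j) (t, j) - c (i, m) (t, m)) * ((q : k) - (q : k)⁻¹) = 0 := by
  have e1 := (h.rel_diag hl hj).anti hl' hj
  simp only [skewCoeff, id_eq, Prod.mk.injEq, hl.ne, hl.ne', hl'.ne, hl'.ne', hj.ne, hj.ne',
    ht, ht.symm, and_true, and_false,
    true_and, false_and, if_true, if_false, add_zero, zero_add, mul_zero, sub_zero] at e1
  linear_combination e1

theorem bystander_above (hl : l < i) (hl' : l < t) (ht : i ≠ t) (hj : j < m) :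
    (s (l, j) * c (i, m) (t, m) - s (l, m) * c (i, j) (t, j)) * ((q : k) - (q : k)⁻¹) = 0 := by
  have e1 := (h.rel_diag hl hj).anti hl' hj
  simp only [skewCoeff, id_eq, Prod.mk.injEq, hl.ne, hl.ne', hl'.ne, hl'.ne', hj.ne, hj.ne',
    ht, ht.symm, and_true, and_false,
    true_and, false_and, if_true, if_false, add_zero, zero_add, mul_zero, sub_zero] at e1
  linear_combination e1

/-- Moving row i past row l turns diagonal pairs into antidiagonal ones and conversely, so the image
of the ν-term is a diagonal monomial that nothing compensates. Only the first column escapes; for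
upward moves, only the last column does. -/
theorem between_lt (hl : i < l) (hl' : l < t) (hj : j < m) :
    c (i, m) (t, m) * ((q : k) - (q : k)⁻¹) = 0 := by
  have e1 := (h.rel_diag hl hj).diag hl' hj
  have ht := hl.trans hl'
  simp only [skewCoeff, id_eq, Prod.mk.injEq, hl.ne, hl.ne', hl'.ne, hl'.ne', hj.ne, hj.ne',
    ht.ne, ht.ne', and_true, and_false,
    true_and, false_and, if_true, if_false, add_zero, zero_add, mul_zero, sub_zero] at e1
  linear_combination -e1

theorem between_gt (hl : l < i) (hl' : t < l) (hj : j < m) :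
    s (l, m) * c (i, j) (t, j) * ((q : k) - (q : k)⁻¹) = 0 := by
  have e1 := (h.rel_diag hl hj).diag hl' hj
  have ht := hl'.trans hl
  simp only [skewCoeff, id_eq, Prod.mk.injEq, hl.ne, hl.ne', hl'.ne, hl'.ne', hj.ne, hj.ne',
    ht.ne, ht.ne', and_true, and_false,
    true_and, false_and, if_true, if_false, add_zero, zero_add, mul_zero, sub_zero] at e1
  linear_combination -e1

end RowEquations

/-! #### Operations changing both the row and the column vanish -/

section Mixed

variable (h : IsSkew q id s c) (hs : ∀ p, s p ≠ 0) (hν : (q : k) - (q : k)⁻¹ ≠ 0)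
  {i t j u l m : Fin N}
include h hν

/-- In the diagonal relation of Y_im and Y_lj the correction term is ν Y_ij Y_lm. As both indices of
Y_ij change, only this term contributes to Y_tu Y_lm. -/
theorem mixed_of_below (hi : i < l) (hj : m < j) (ht : t ≠ i) (hu : u ≠ j) :
    c (i, j) (t, u) = 0 := by
  have e := (h.rel_diag hi hj).eq_zero_of (t, u) (l, m)
    (by grind [skewCoeff]) (by grind [skewCoeff])
  simp only [skewCoeff, id_eq, Prod.mk.injEq, hi.ne, hi.ne', hj.ne, hj.ne', ht, hu, ht.symm,
    hu.symm, and_true, and_false,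
    true_and, false_and, if_true, if_false, add_zero, zero_add, mul_zero, sub_zero] at e
  exact (mul_eq_zero.mp (show ((q : k) - (q : k)⁻¹) * c (i, j) (t, u) = 0 by
    linear_combination -e)).resolve_left hν

include hs in
theorem mixed_of_above (hi : l < i) (hj : j < m) (ht : t ≠ i) (hu : u ≠ j) :
    c (i, j) (t, u) = 0 := by
  have e := (h.rel_diag hi hj).eq_zero_of (l, m) (t, u)
    (by grind [skewCoeff]) (by grind [skewCoeff])
  simp only [skewCoeff, id_eq, Prod.mk.injEq, hi.ne, hi.ne', hj.ne, hj.ne', ht, hu, ht.symm,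
    hu.symm, and_true, and_false,
    true_and, false_and, if_true, if_false, add_zero, zero_add, mul_zero, sub_zero] at e
  refine (mul_eq_zero.mp (show ((q : k) - (q : k)⁻¹) * s (l, m) * c (i, j) (t, u) = 0 by
    linear_combination -e)).resolve_left (mul_ne_zero hν (hs _))

include hs in
-- The upper left corner has no partner to its lower left or upper right. The relation used here
-- creates Y_im Y_tu in the wrong order; reordering leaves a ν-term on the antidiagonal that nothing
-- cancels. The remaining corner lemmas work in the same way.
theorem mixed_first_row (hi : i < t) (hj : j < m) (hm : m < u) : c (i, j) (t, u) = 0 := by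
  have e := (h.rel_row i hj).anti hi hm
  have := hj.trans hm
  simp only [skewCoeff, id_eq, Prod.mk.injEq, hi.ne, hi.ne', hj.ne, hj.ne', hm.ne, hm.ne',
    this.ne, this.ne', and_true, and_false,
    true_and, false_and, if_true, if_false, add_zero, zero_add, mul_zero, sub_zero] at e
  refine (mul_eq_zero.mp (show (q * s (i, m) * ((q : k) - (q : k)⁻¹)) * c (i, j) (t, u) = 0 by
    linear_combination -e)).resolve_left (mul_ne_zero (mul_ne_zero q.ne_zero (hs _)) hν)

include hs in
theorem mixed_first_col (hi : i < l) (hl : l < t) (hj : j < u) : c (i, j) (t, u) = 0 := by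
  have e := (h.rel_col j hi).anti hl hj
  have := hi.trans hl
  simp only [skewCoeff, id_eq, Prod.mk.injEq, hi.ne, hi.ne', hj.ne, hj.ne', hl.ne, hl.ne',
    this.ne, this.ne', and_true, and_false,
    true_and, false_and, if_true, if_false, add_zero, zero_add, mul_zero, sub_zero] at e
  refine (mul_eq_zero.mp (show (q * s (l, j) * ((q : k) - (q : k)⁻¹)) * c (i, j) (t, u) = 0 by
    linear_combination -e)).resolve_left (mul_ne_zero (mul_ne_zero q.ne_zero (hs _)) hν)

theorem mixed_first_diag (hi : i < t) (hl : t < l) (hj : j < u) (hm : u < m) :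
    c (i, j) (t, u) = 0 := by
  have e := (h.rel_diag (hi.trans hl) (hj.trans hm)).anti hl hm
  have h1 := hi.trans hl
  have h2 := hj.trans hm
  simp only [skewCoeff, id_eq, Prod.mk.injEq, hi.ne, hi.ne', hj.ne, hj.ne', hl.ne, hl.ne',
    hm.ne, hm.ne', h1.ne, h1.ne', h2.ne, h2.ne', and_true, and_false,
    true_and, false_and, if_true, if_false, add_zero, zero_add, mul_zero, sub_zero] at e
  exact (mul_eq_zero.mp (show c (i, j) (t, u) * ((q : k) - (q : k)⁻¹) = 0 by
    linear_combination e)).resolve_right hν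

theorem mixed_last_row (hi : t < i) (hm : u < m) (hj : m < j) : c (i, j) (t, u) = 0 := by
  have e := (h.rel_row i hj).anti hi hm
  have := hm.trans hj
  simp only [skewCoeff, id_eq, Prod.mk.injEq, hi.ne, hi.ne', hj.ne, hj.ne', hm.ne, hm.ne',
    this.ne, this.ne', and_true, and_false,
    true_and, false_and, if_true, if_false, add_zero, zero_add, mul_zero, sub_zero] at e
  refine (mul_eq_zero.mp (show (q * ((q : k) - (q : k)⁻¹)) * c (i, j) (t, u) = 0 by
    linear_combination -e)).resolve_left (mul_ne_zero q.ne_zero hν)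

theorem mixed_last_col (hl : t < l) (hi : l < i) (hj : u < j) : c (i, j) (t, u) = 0 := by
  have e := (h.rel_col j hi).anti hl hj
  have := hl.trans hi
  simp only [skewCoeff, id_eq, Prod.mk.injEq, hi.ne, hi.ne', hj.ne, hj.ne', hl.ne, hl.ne',
    this.ne, this.ne', and_true, and_false,
    true_and, false_and, if_true, if_false, add_zero, zero_add, mul_zero, sub_zero] at e
  refine (mul_eq_zero.mp (show (q * ((q : k) - (q : k)⁻¹)) * c (i, j) (t, u) = 0 by
    linear_combination -e)).resolve_left (mul_ne_zero q.ne_zero hν)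

include hs in
theorem mixed_last_diag (hl : l < t) (hi : t < i) (hm : m < u) (hj : u < j) :
    c (i, j) (t, u) = 0 := by
  have e := (h.rel_diag (hl.trans hi) (hm.trans hj)).anti hl hm
  have h1 := hl.trans hi
  have h2 := hm.trans hj
  simp only [skewCoeff, id_eq, Prod.mk.injEq, hi.ne, hi.ne', hj.ne, hj.ne', hl.ne, hl.ne',
    hm.ne, hm.ne', h1.ne, h1.ne', h2.ne, h2.ne', and_true, and_false,
    true_and, false_and, if_true, if_false, add_zero, zero_add, mul_zero, sub_zero] at e
  refine (mul_eq_zero.mp (show (s (l, m) * ((q : k) - (q : k)⁻¹)) * c (i, j) (t, u) = 0 by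
    linear_combination e)).resolve_left (mul_ne_zero (hs _) hν)

include hs in
/-- A skew derivation with diagonal twist changes the row or the column of a generator, not
both. -/
theorem mixed_eq_zero (hN : 3 ≤ N) (ht : t ≠ i) (hu : u ≠ j) : c (i, j) (t, u) = 0 := by
  -- A partner to the lower left or upper right exists except at the upper left and lower right
  -- corners.
  by_cases hb : (i : ℕ) + 1 < N ∧ 0 < (j : ℕ)
  · exact h.mixed_of_below hν (l := ⟨i + 1, hb.1⟩) (m := ⟨0, by omega⟩)
      (Fin.lt_def.mpr (by simp)) (Fin.lt_def.mpr hb.2) ht hu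
  by_cases ha : 0 < (i : ℕ) ∧ (j : ℕ) + 1 < N
  · exact h.mixed_of_above hs hν (l := ⟨0, by omega⟩) (m := ⟨j + 1, ha.2⟩)
      (Fin.lt_def.mpr ha.1) (Fin.lt_def.mpr (by simp)) ht hu
  have ht' : (t : ℕ) ≠ i := fun e => ht (Fin.ext e)
  have hu' : (u : ℕ) ≠ j := fun e => hu (Fin.ext e)
  obtain ⟨hi0, hj0⟩ | ⟨hi1, hj1⟩ : ((i : ℕ) = 0 ∧ (j : ℕ) = 0) ∨
      ((i : ℕ) + 1 = N ∧ (j : ℕ) + 1 = N) := by omega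
  · by_cases h1 : 1 < (u : ℕ)
    · exact h.mixed_first_row hs hν (m := ⟨1, by omega⟩) (Fin.lt_def.mpr (by omega))
        (Fin.lt_def.mpr (by simp; omega)) (Fin.lt_def.mpr (by simpa using h1))
    by_cases h2 : 1 < (t : ℕ)
    · exact h.mixed_first_col hs hν (l := ⟨1, by omega⟩) (Fin.lt_def.mpr (by simp; omega))
        (Fin.lt_def.mpr (by simpa using h2)) (Fin.lt_def.mpr (by omega))
    -- Only the target (1, 1), counting from 0, is left; the auxiliary generator (2, 2) exists
    -- because N ≥ 3.
    · exact h.mixed_first_diag hν (l := ⟨2, by omega⟩) (m := ⟨2, by omega⟩)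
        (Fin.lt_def.mpr (by omega)) (Fin.lt_def.mpr (by simp; omega))
        (Fin.lt_def.mpr (by omega)) (Fin.lt_def.mpr (by simp; omega))
  · by_cases h1 : (u : ℕ) + 2 < N
    · exact h.mixed_last_row hν (m := ⟨u + 1, by omega⟩) (Fin.lt_def.mpr (by omega))
        (Fin.lt_def.mpr (by simp)) (Fin.lt_def.mpr (by simp; omega))
    by_cases h2 : (t : ℕ) + 2 < N
    · exact h.mixed_last_col hν (l := ⟨t + 1, by omega⟩) (Fin.lt_def.mpr (by simp))
        (Fin.lt_def.mpr (by simp; omega)) (Fin.lt_def.mpr (by omega))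
    · exact h.mixed_last_diag hs hν (l := ⟨0, by omega⟩) (m := ⟨0, by omega⟩)
        (Fin.lt_def.mpr (by simp; omega)) (Fin.lt_def.mpr (by omega))
        (Fin.lt_def.mpr (by simp; omega)) (Fin.lt_def.mpr (by omega))

end Mixed

end IsSkew

end QMat

/-! ### Diagonal twists: classification of the entries within a column -/

namespace QMat

variable {k : Type*} [Field k] {N : ℕ} {q : kˣ}

/-- The diagonal twist of the row operations between the rows `r` and `r'`. -/
def IsEdgeTwist (q : kˣ) (s : Fin N × Fin N → k) (r r' : Fin N) : Prop :=
  ∀ m, s (r, m) = q ∧ s (r', m) = (q : k)⁻¹ ∧ ∀ l, l ≠ r → l ≠ r' → s (l, m) = 1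

namespace IsSkew

variable {s : Fin N × Fin N → k} {c : Fin N × Fin N → Fin N × Fin N → k}
  (h : IsSkew q id s c) (hs : ∀ p, s p ≠ 0) (hν : (q : k) - (q : k)⁻¹ ≠ 0)
  {i t j m l : Fin N}
include h hν

theorem const_of_below (hl : i < l) (hl' : t < l) (ht : i ≠ t) (j m : Fin N) :
    c (i, j) (t, j) = c (i, m) (t, m) := by
  rcases lt_trichotomy j m with hj | rfl | hj
  · exact sub_eq_zero.mp ((mul_eq_zero.mp (h.bystander_below hl hl' ht hj)).resolve_right hν)
  · rfl
  · exact (sub_eq_zero.mp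
      ((mul_eq_zero.mp (h.bystander_below hl hl' ht hj)).resolve_right hν)).symm

include hs in
-- Here the comparison of two columns carries the factors s (l, j) and s (l, m). These equal 1
-- wherever `c` is not zero, and being nonzero they also transport vanishing.
theorem const_of_above (hl : l < i) (hl' : l < t) (ht : i ≠ t) (j m : Fin N) :
    c (i, j) (t, j) = c (i, m) (t, m) := by
  have key : ∀ j m : Fin N, j < m → c (i, j) (t, j) = c (i, m) (t, m) := by
    intro j m hj
    have e := sub_eq_zero.mp ((mul_eq_zero.mp (h.bystander_above hl hl' ht hj)).resolve_right hν)
    have e1 := h.bystander_col_above hl hl' ht j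
    have e2 := h.bystander_col_above hl hl' ht m
    by_cases hc : c (i, j) (t, j) = 0
    · rw [hc, mul_zero] at e
      rw [hc, (mul_eq_zero.mp e).resolve_left (hs _)]
    · have e3 : s (l, j) = 1 := mul_right_cancel₀ hc (by rw [e1, one_mul])
      have hc' : c (i, m) (t, m) ≠ 0 := by
        intro h0
        rw [h0, mul_zero] at e
        exact mul_ne_zero (hs _) hc e.symm
      have e4 : s (l, m) = 1 := mul_right_cancel₀ hc' (by rw [e2, one_mul])
      rw [e3, e4] at e
      linear_combination -e
  rcases lt_trichotomy j m with hj | rfl | hj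
  · exact key _ _ hj
  · rfl
  · exact (key _ _ hj).symm

include hs in
theorem const_of_outside (hl : (i < l ∧ t < l) ∨ (l < i ∧ l < t)) (ht : i ≠ t) (j m : Fin N) :
    c (i, j) (t, j) = c (i, m) (t, m) := by
  rcases hl with hl | hl
  · exact h.const_of_below hν hl.1 hl.2 ht j m
  · exact h.const_of_above hs hν hl.1 hl.2 ht j m

omit hν in
theorem bystander_eq_one (hl : (i < l ∧ t < l) ∨ (l < i ∧ l < t)) (ht : i ≠ t)
    (hc : c (i, j) (t, j) ≠ 0) : s (l, j) = 1 := by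
  refine mul_right_cancel₀ hc ?_
  rw [one_mul]
  rcases hl with hl | hl
  · exact h.bystander_col_below hl.1 hl.2 ht j
  · exact h.bystander_col_above hl.1 hl.2 ht j

include hs in
/-- A nonzero entry `c (i, j) (t, j)` with `i < t` comes from an adjacent row operation or from
the exceptional map `Y_11 ↦ Y_N1`. -/
theorem down_arrow (hN : 3 ≤ N) (ht : i < t) (hc : c (i, j) (t, j) ≠ 0) :
    ((i : ℕ) + 1 = t ∧ IsEdgeTwist q s i t ∧ ∀ m, c (i, m) (t, m) ≠ 0) ∨
    ((i : ℕ) = 0 ∧ (t : ℕ) + 1 = N ∧ (j : ℕ) = 0 ∧ s (t, j) = (q : k)⁻¹ ∧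
      ∀ m, j < m → s (i, m) = (q : k)⁻¹ ∧ s (t, m) = q) := by
  have hq := q.ne_zero
  -- A row outside the interval from i to t makes the coefficient constant along the columns.
  -- Without one, i and t are the first and last rows, and N ≥ 3 supplies a row in between.
  by_cases hout : ∃ l, (i < l ∧ t < l) ∨ (l < i ∧ l < t)
  · left
    obtain ⟨l₀, hl₀⟩ := hout
    have hconst := h.const_of_outside hs hν hl₀ ht.ne j
    have hc' : ∀ m, c (i, m) (t, m) ≠ 0 := fun m => by rw [← hconst m]; exact hc
    have hadj : (i : ℕ) + 1 = t := by
      by_contra hne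
      have hlt := Fin.lt_def.mp ht
      have := h.between_lt (i := i) (t := t) (l := ⟨i + 1, by omega⟩) (j := ⟨0, by omega⟩) (m := ⟨1, by omega⟩)
        (Fin.lt_def.mpr (by simp)) (Fin.lt_def.mpr (by simp; omega)) (Fin.lt_def.mpr (by simp))
      exact (mul_ne_zero (hc' _) hν) this
    refine ⟨hadj, fun m => ⟨?_, ?_, fun l hl hl' => ?_⟩, hc'⟩
    · by_cases hm : (m : ℕ) + 1 < N
      · have e := (h.source_lt (j := m) (m := ⟨m + 1, hm⟩) ht (Fin.lt_def.mpr (by simp))).1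
        exact mul_right_cancel₀ (hc' _) e
      -- The last column has no column after it, so it is compared with the first one through the
      -- ν-equation.
      · have hlt : (⟨0, by omega⟩ : Fin N) < m := Fin.lt_def.mpr (by simp; omega)
        obtain ⟨e1, e2⟩ := h.source_lt ht hlt
        have e1' := mul_right_cancel₀ (hc' _) e1
        rw [e1', ← hconst m, ← hconst ⟨0, by omega⟩] at e2
        have e3 : (q : k) * c (i, j) (t, j) * (q - s (i, m)) = 0 := by
          field_simp at e2
          linear_combination e2
        exact (sub_eq_zero.mp ((mul_eq_zero.mp e3).resolve_left (mul_ne_zero hq hc))).symm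
    · have e := h.target_sq_lt ht m
      refine eq_inv_of_mul_eq_one_left (mul_right_cancel₀ (hc' m) ?_)
      linear_combination -e
    · refine h.bystander_eq_one ?_ ht.ne (hc' m)
      have h1 : (l : ℕ) ≠ i := fun e => hl (Fin.ext e)
      have h2 : (l : ℕ) ≠ t := fun e => hl' (Fin.ext e)
      simp only [Fin.lt_def]
      omega
  · right
    have hi0 : (i : ℕ) = 0 := by
      by_contra hne
      exact hout ⟨⟨0, by omega⟩, .inr ⟨Fin.lt_def.mpr (by simp; omega),
        Fin.lt_def.mpr (by have := Fin.lt_def.mp ht; simp; omega)⟩⟩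
    have htN : (t : ℕ) + 1 = N := by
      by_contra hne
      exact hout ⟨⟨N - 1, by omega⟩, .inl ⟨Fin.lt_def.mpr (by have := Fin.lt_def.mp ht; simp; omega),
        Fin.lt_def.mpr (by simp; omega)⟩⟩
    have hz : ∀ j m : Fin N, j < m → c (i, m) (t, m) = 0 := by
      intro j m hj
      have := h.between_lt (l := ⟨1, by omega⟩) (i := i) (t := t)
        (Fin.lt_def.mpr (by simp; omega)) (Fin.lt_def.mpr (by simp; omega)) hj
      exact (mul_eq_zero.mp this).resolve_right hν
    have hj0 : (j : ℕ) = 0 := by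
      by_contra hne
      exact hc (hz ⟨0, by omega⟩ j (Fin.lt_def.mpr (by simp; omega)))
    refine ⟨hi0, htN, hj0, ?_, fun m hm => ⟨?_, ?_⟩⟩
    · have e := h.target_sq_lt ht j
      refine eq_inv_of_mul_eq_one_left (mul_right_cancel₀ hc ?_)
      linear_combination -e
    · have e := (h.source_lt ht hm).2
      rw [hz j m hm] at e
      refine eq_inv_of_mul_eq_one_left (mul_right_cancel₀ hc ?_)
      linear_combination -e
    · have e := h.target_lt ht hm
      rw [hz j m hm] at e
      refine mul_right_cancel₀ hc ?_
      linear_combination -e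

include hs in
/-- A nonzero entry `c (i, j) (t, j)` with `t < i` comes from an adjacent row operation or from
the exceptional map `Y_NN ↦ Y_1N`. -/
theorem up_arrow (hN : 3 ≤ N) (ht : t < i) (hc : c (i, j) (t, j) ≠ 0) :
    ((t : ℕ) + 1 = i ∧ IsEdgeTwist q s t i ∧ ∀ m, c (i, m) (t, m) ≠ 0) ∨
    ((t : ℕ) = 0 ∧ (i : ℕ) + 1 = N ∧ (j : ℕ) + 1 = N ∧ s (t, j) = q ∧
      ∀ m, m < j → s (i, m) = q ∧ s (t, m) = (q : k)⁻¹) := by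
  have hq := q.ne_zero
  by_cases hout : ∃ l, (i < l ∧ t < l) ∨ (l < i ∧ l < t)
  · left
    obtain ⟨l₀, hl₀⟩ := hout
    have hconst := h.const_of_outside hs hν hl₀ ht.ne' j
    have hc' : ∀ m, c (i, m) (t, m) ≠ 0 := fun m => by rw [← hconst m]; exact hc
    have hadj : (t : ℕ) + 1 = i := by
      by_contra hne
      have hlt := Fin.lt_def.mp ht
      have := h.between_gt (i := i) (t := t) (l := ⟨t + 1, by omega⟩) (j := ⟨0, by omega⟩) (m := ⟨1, by omega⟩)
        (Fin.lt_def.mpr (by simp; omega)) (Fin.lt_def.mpr (by simp)) (Fin.lt_def.mpr (by simp))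
      exact (mul_ne_zero (mul_ne_zero (hs _) (hc' _)) hν) this
    refine ⟨hadj, fun m => ⟨?_, ?_, fun l hl hl' => ?_⟩, hc'⟩
    · exact mul_right_cancel₀ (hc' m) (h.target_sq_gt ht m)
    · by_cases hm : (m : ℕ) + 1 < N
      · have e := (h.source_gt (j := m) (m := ⟨m + 1, hm⟩) ht (Fin.lt_def.mpr (by simp))).2
        rw [← hconst m, ← hconst ⟨m + 1, hm⟩] at e
        refine mul_right_cancel₀ hc ?_
        linear_combination e
      · have hlt : (⟨0, by omega⟩ : Fin N) < m := Fin.lt_def.mpr (by simp; omega)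
        have e := (h.source_gt ht hlt).1
        refine eq_inv_of_mul_eq_one_left (mul_right_cancel₀ (hc' ⟨0, by omega⟩) ?_)
        linear_combination -e
    · refine h.bystander_eq_one ?_ ht.ne' (hc' m)
      have h1 : (l : ℕ) ≠ i := fun e => hl' (Fin.ext e)
      have h2 : (l : ℕ) ≠ t := fun e => hl (Fin.ext e)
      simp only [Fin.lt_def]
      omega
  · right
    have ht0 : (t : ℕ) = 0 := by
      by_contra hne
      exact hout ⟨⟨0, by omega⟩, .inr ⟨Fin.lt_def.mpr (by have := Fin.lt_def.mp ht; simp; omega),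
        Fin.lt_def.mpr (by simp; omega)⟩⟩
    have hiN : (i : ℕ) + 1 = N := by
      by_contra hne
      exact hout ⟨⟨N - 1, by omega⟩, .inl ⟨Fin.lt_def.mpr (by simp; omega),
        Fin.lt_def.mpr (by have := Fin.lt_def.mp ht; simp; omega)⟩⟩
    -- Row 1 lies strictly between the two rows and kills every column except the last.
    have hz : ∀ j m : Fin N, j < m → c (i, j) (t, j) = 0 := by
      intro j m hj
      have := h.between_gt (l := ⟨1, by omega⟩) (i := i) (t := t)
        (Fin.lt_def.mpr (by simp; omega)) (Fin.lt_def.mpr (by simp; omega)) hj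
      exact (mul_eq_zero.mp ((mul_eq_zero.mp this).resolve_right hν)).resolve_left (hs _)
    have hjN : (j : ℕ) + 1 = N := by
      by_contra hne
      exact hc (hz j ⟨N - 1, by omega⟩ (Fin.lt_def.mpr (by simp; omega)))
    refine ⟨ht0, hiN, hjN, mul_right_cancel₀ hc (h.target_sq_gt ht j), fun m hm => ⟨?_, ?_⟩⟩
    · have e := (h.source_gt ht hm).2
      rw [hz m j hm] at e
      refine mul_right_cancel₀ hc ?_
      linear_combination e
    · have e := h.target_gt ht hm
      rw [hz m j hm] at e
      refine eq_inv_of_mul_eq_one_left (mul_right_cancel₀ hc ?_)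
      linear_combination e

end IsSkew

end QMat

/-! ### Twists involving the transposition -/

namespace QMat

variable {k : Type*} [Field k] {N : ℕ} {q : kˣ}

namespace IsSkew

variable {π : Fin N × Fin N → Fin N × Fin N} {s : Fin N × Fin N → k}
  {c : Fin N × Fin N → Fin N × Fin N → k}

/-- Two generators in the same row or column `q`-commute. -/
theorem rel_line (h : IsSkew q π s c) {p r : Fin N × Fin N} (hpr : p ≠ r)
    (hl : p.1 = r.1 ∨ p.2 = r.2) : ∃ α β : k, α ≠ 0 ∧ QuadZero q fun a b =>
      α * skewCoeff π s c p r a b + β * skewCoeff π s c r p a b := by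
  obtain ⟨i, j⟩ := p
  obtain ⟨l, m⟩ := r
  have hq := q.ne_zero
  rcases hl with rfl | rfl
  · rcases lt_or_gt_of_ne (show j ≠ m by simpa using hpr) with hj | hj
    · exact ⟨1, -q, one_ne_zero, by simpa [sub_eq_add_neg] using h.rel_row i hj⟩
    · exact ⟨-q, 1, neg_ne_zero.mpr hq,
        by simpa [sub_eq_add_neg, add_comm] using h.rel_row i hj⟩
  · rcases lt_or_gt_of_ne (show i ≠ l by simpa using hpr) with hi | hi
    · exact ⟨1, -q, one_ne_zero, by simpa [sub_eq_add_neg] using h.rel_col j hi⟩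
    · exact ⟨-q, 1, neg_ne_zero.mpr hq,
        by simpa [sub_eq_add_neg, add_comm] using h.rel_col j hi⟩

/-- The generator in the upper right corner `q`-commutes with all the others. -/
theorem rel_corner (h : IsSkew q π s c) {o e : Fin N}
    (ho : ∀ i, o ≤ i) (he : ∀ i, i ≤ e) {p : Fin N × Fin N} (hp : p ≠ (o, e)) :
    ∃ α β : k, α ≠ 0 ∧ QuadZero q fun a b =>
      α * skewCoeff π s c (o, e) p a b + β * skewCoeff π s c p (o, e) a b := by
  by_cases hl : (o, e).1 = p.1 ∨ (o, e).2 = p.2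
  · exact h.rel_line hp.symm hl
  · rw [not_or] at hl
    exact ⟨1, -1, one_ne_zero, by
      simpa [sub_eq_add_neg] using h.rel_anti (lt_of_le_of_ne (ho p.1) hl.1)
        (lt_of_le_of_ne (he p.2) (Ne.symm hl.2))⟩

section Swap

variable (h : IsSkew q Prod.swap s c) (hs : ∀ p, s p ≠ 0) (h0 : ∀ p, c p p = 0)
  (h1 : ∀ p : Fin N × Fin N, c p p.swap = 0) {o e : Fin N}
  (ho : ∀ i, o ≤ i) (he : ∀ i, i ≤ e)
include h h0 h1 ho he

/-- The relation between the corner Y_oe and a suitable Y_p contains X(Y_oe) Y_p; the coefficient of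
Y_a Y_p isolates c (o, e) a. -/
theorem swap_corner (hoe : o < e) {u : Fin N} (hu : o < u) (hu' : u < e) (a : Fin N × Fin N) :
    c (o, e) a = 0 := by
  by_cases ha : a = (o, e)
  · rw [ha]; exact h0 _
  by_cases ha' : a = (e, o)
  · rw [ha']; exact h1 (o, e)
  -- Being off the diagonal, p differs from its transpose; the two candidates leave one with p ≠
  -- a.swap, so no twisted term interferes.
  obtain ⟨p, hp, hpa⟩ : ∃ p : Fin N × Fin N, (p = (o, u) ∨ p = (u, o)) ∧ p ≠ a.swap := by
    by_cases h2 : (o, u) = a.swap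
    · exact ⟨(u, o), .inr rfl, by grind⟩
    · exact ⟨(o, u), .inl rfl, h2⟩
  obtain ⟨α, β, hα, hC⟩ := h.rel_corner ho he (p := p) (by grind)
  have e1 := hC.eq_zero_of a p
    (by
      obtain ⟨a1, a2⟩ := a
      grind [skewCoeff, Prod.swap])
    (by
      intro i l j m hi hj hc
      have := ho i; have := he l; have := ho j; have := he m
      grind [skewCoeff, Prod.swap])
  have e2 : α * c (o, e) a = 0 := by grind [skewCoeff, Prod.swap]
  exact (mul_eq_zero.mp e2).resolve_left hα

include hs

/-- The twist sends the corner Y_oe to a multiple of Y_eo. Since X(Y_oe) = 0, the coefficient of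
Y_eo Y_a in the relation with Y_p isolates c p a. -/
theorem swap_noncorner (hoe : o < e) {u : Fin N} (hu : o < u) (hu' : u < e)
    (p : Fin N × Fin N) {a : Fin N × Fin N} (ha : a ≠ (o, e)) :
    c p a = 0 := by
  have hw := h.swap_corner h0 h1 ho he hoe hu hu'
  by_cases hp : p = (o, e)
  · rw [hp]; exact hw a
  obtain ⟨α, β, hα, hC⟩ := h.rel_corner ho he hp
  have e1 := hC.eq_zero_of (e, o) a
    (by grind [skewCoeff, Prod.swap])
    (by
      intro i l j m hi hj hc
      have := ho i; have := he l; have := ho j; have := he m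
      grind [skewCoeff, Prod.swap])
  have e2 : α * s (o, e) * c p a = 0 := by grind [skewCoeff, Prod.swap]
  exact (mul_eq_zero.mp e2).resolve_left (mul_ne_zero hα (hs _))

theorem swap_eq_zero (hoe : o < e) {u : Fin N} (hu : o < u) (hu' : u < e)
    (p a : Fin N × Fin N) : c p a = 0 := by
  have hz := fun p a => h.swap_noncorner hs h0 h1 ho he hoe hu hu' p (a := a)
  by_cases hp : p = (o, e)
  · rw [hp]; exact h.swap_corner h0 h1 ho he hoe hu hu' a
  by_cases ha : a = (o, e)
  swap
  · exact hz _ _ ha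
  by_cases hp' : p = (e, o)
  · rw [ha, hp']
    exact h1 (e, o)
  -- Only entries with target the corner remain. A generator Y_r in line with Y_p, different from
  -- both transposes p.swap and r.swap, makes X(Y_p) Y_r the only source of Y_oe Y_r.
  obtain ⟨r, hrp, hrp', hl, hr, hro⟩ : ∃ r : Fin N × Fin N, p ≠ r ∧ p.swap ≠ r ∧
      (p.1 = r.1 ∨ p.2 = r.2) ∧ r.1 ≠ r.2 ∧ r ≠ (o, e) := by
    obtain ⟨i, j⟩ := p
    by_cases hij : i = j
    · by_cases hiu : i = u
      · exact ⟨(i, o), by grind⟩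
      · exact ⟨(i, u), by grind⟩
    · obtain ⟨v, hvi, hvj⟩ : ∃ v : Fin N, v ≠ i ∧ v ≠ j := by
        by_cases hoi : o ≠ i ∧ o ≠ j
        · exact ⟨o, hoi⟩
        by_cases hei : e ≠ i ∧ e ≠ j
        · exact ⟨e, hei⟩
        exact ⟨u, by grind⟩
      by_cases hi : i = o ∨ i = e
      · exact ⟨(v, j), by grind⟩
      · exact ⟨(i, v), by grind⟩
  obtain ⟨α, β, hα, hC⟩ := h.rel_line hrp hl
  have e1 := hC.eq_zero_of a r
    (by
      obtain ⟨r1, r2⟩ := r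
      grind [skewCoeff, Prod.swap])
    (by
      intro i l j m hi hj hc
      have := ho i; have := he l; have := ho j; have := he m
      have z1 : ∀ p, c p (l, m) = 0 := fun p => hz _ _ (by grind)
      have z2 : ∀ p, c p (i, j) = 0 := fun p => hz _ _ (by grind)
      simp [skewCoeff, z1, z2])
  have e2 : α * c p a = 0 := by
    obtain ⟨p1, p2⟩ := p
    obtain ⟨r1, r2⟩ := r
    grind [skewCoeff, Prod.swap]
  exact (mul_eq_zero.mp e2).resolve_left hα

end Swap

end IsSkew

end QMat

/-! ### Counting the members of a family -/

namespace QMat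

variable {k : Type*} [Field k] {N : ℕ} {q : kˣ}

/-- Finitely many skew derivations with diagonal twists, given by matrices on generators, subject
to the relations of a quantum linear space; `χ i j` is the value of the `i`-th character on the
`j`-th group element. -/
structure SkewFamily (q : kˣ) (N θ : ℕ) where
  s : Fin θ → Fin N × Fin N → k
  c : Fin θ → Fin N × Fin N → Fin N × Fin N → k
  χ : Fin θ → Fin θ → k
  skew : ∀ i, IsSkew q id (s i) (c i)
  ne_zero : ∀ i p, s i p ≠ 0
  rank_one : ∀ i l m l' m', s i (l, m) * s i (l', m') = s i (l, m') * s i (l', m)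
  eigen : ∀ i j p b, c i p b ≠ 0 → s j b = χ i j * s j p
  compat : ∀ i j, i ≠ j → χ i j * χ j i = 1
  sq_ne_one : ∀ i, χ i i ^ 2 ≠ 1
  comm : ∀ i j, i ≠ j → ∀ p b, ∑ r, c j p r * c i r b = χ j i * ∑ r, c i p r * c j r b
  exists_ne_zero : ∀ i, ∃ p b, c i p b ≠ 0

namespace SkewFamily

variable {θ : ℕ}

/-- The family obtained by interchanging rows and columns. -/
def transpose (F : SkewFamily q N θ) : SkewFamily q N θ where
  s i p := F.s i p.swap
  c i p b := F.c i p.swap b.swap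
  χ := F.χ
  skew i := (F.skew i).transpose
  ne_zero i p := F.ne_zero i _
  rank_one i l m l' m' := by
    rw [mul_comm (F.s i (l, m').swap)]
    exact F.rank_one i _ _ _ _
  eigen i j p b := F.eigen i j _ _
  compat := F.compat
  sq_ne_one := F.sq_ne_one
  comm i j hij p b := by
    have e := F.comm i j hij p.swap b.swap
    rw [← Equiv.sum_comp (Equiv.prodComm _ _),
      ← Equiv.sum_comp (Equiv.prodComm _ _) fun r => F.c i p.swap r * _] at e
    exact e
  exists_ne_zero i := by
    obtain ⟨p, b, h⟩ := F.exists_ne_zero i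
    exact ⟨p.swap, b.swap, by simpa using h⟩

/-- The ways in which a member of the family may be attached to the pair of adjacent rows `r`,
`r'`: as a row operation between them, or as an exceptional map within the first or the last
row. -/
inductive Attached (F : SkewFamily q N θ) (i : Fin θ) (r r' : Fin N) : Prop
  | down (hs : IsEdgeTwist q (F.s i) r r') (hc : ∀ m, F.c i (r, m) (r', m) ≠ 0)
  | up (hs : IsEdgeTwist q (F.s i) r r') (hc : ∀ m, F.c i (r', m) (r, m) ≠ 0)
  | first (o e : Fin N) (hr : r = o) (ho : (o : ℕ) = 0) (he : (e : ℕ) + 1 = N)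
      (hs : ∀ m, F.s i (r', m) = q ^ 2 * F.s i (r, m))
      (hs' : F.s i (o, e) = q ^ 2 * F.s i (o, o)) (hc : F.c i (o, o) (o, e) ≠ 0)
  | last (o e : Fin N) (hr : r' = e) (ho : (o : ℕ) = 0) (he : (e : ℕ) + 1 = N)
      (hs : ∀ m, F.s i (r', m) = q ^ 2 * F.s i (r, m))
      (hs' : F.s i (e, e) = q ^ 2 * F.s i (e, o)) (hc : F.c i (e, e) (e, o) ≠ 0)

/-- The twist has rank one, so the ratio of two columns is the same in every row. -/
theorem ratio_eq (F : SkewFamily q N θ) {i : Fin θ} {l m m' : Fin N} {x : k}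
    (h : F.s i (l, m') = x * F.s i (l, m)) (l' : Fin N) :
    F.s i (l', m') = x * F.s i (l', m) := by
  have e := F.rank_one i l m l' m'
  rw [h] at e
  exact mul_left_cancel₀ (F.ne_zero i (l, m)) (by linear_combination e)

theorem exists_attached_of_same_col (F : SkewFamily q N θ) (hN : 3 ≤ N)
    (hν : (q : k) - (q : k)⁻¹ ≠ 0) {i : Fin θ} {a t j : Fin N} (ht : a ≠ t)
    (hc : F.c i (a, j) (t, j) ≠ 0) :
    ∃ r r' : Fin N, (r : ℕ) + 1 = r' ∧ (F.Attached i r r' ∨ F.transpose.Attached i r r') := by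
  have hq := q.ne_zero
  rcases lt_or_gt_of_ne ht with ht | ht
  · rcases (F.skew i).down_arrow (F.ne_zero i) hν hN ht hc with
      ⟨h1, h2, h3⟩ | ⟨h1, h2, h3, h4, h5⟩
    · exact ⟨a, t, h1, .inl (.down h2 h3)⟩
    · obtain rfl : a = j := Fin.ext (by omega)
      -- The exceptional entry Y_11 ↦ Y_N1 fixes the twist on rows 1 and N; its second column is q²
      -- times its first. It is therefore charged to the first two columns.
      obtain ⟨h6, h7⟩ := h5 ⟨1, by omega⟩ (Fin.lt_def.mpr (by simp; omega))
      have h8 : ∀ l, F.s i (l, ⟨1, by omega⟩) = q ^ 2 * F.s i (l, a) :=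
        F.ratio_eq (l := t) (by rw [h7, h4]; field_simp)
      refine ⟨a, ⟨1, by omega⟩, by simp; omega, .inr (.first a t rfl h1 h2 h8 ?_ hc)⟩
      change F.s i (t, a) = q ^ 2 * F.s i (a, a)
      rw [h4, ← h8, h6]
  · rcases (F.skew i).up_arrow (F.ne_zero i) hν hN ht hc with
      ⟨h1, h2, h3⟩ | ⟨h1, h2, h3, h4, h5⟩
    · exact ⟨t, a, h1, .inl (.up h2 h3)⟩
    · obtain rfl : a = j := Fin.ext (by omega)
      obtain ⟨h6, h7⟩ := h5 ⟨N - 2, by omega⟩ (Fin.lt_def.mpr (by simp; omega))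
      have h8 : ∀ l, F.s i (l, a) = q ^ 2 * F.s i (l, ⟨N - 2, by omega⟩) :=
        F.ratio_eq (l := t) (by rw [h7, h4]; field_simp)
      refine ⟨⟨N - 2, by omega⟩, a, by simp; omega, .inr (.last t a rfl h1 h2 h8 ?_ hc)⟩
      change F.s i (a, a) = q ^ 2 * F.s i (t, a)
      rw [h8, h6, h4]

theorem apply_self (F : SkewFamily q N θ) (i : Fin θ) (p : Fin N × Fin N) : F.c i p p = 0 := by
  by_contra hc
  have e := F.eigen i i p p hc
  have : F.χ i i = 1 := mul_right_cancel₀ (F.ne_zero i p) (by rw [← e, one_mul])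
  exact F.sq_ne_one i (by rw [this, one_pow])

theorem exists_attached (F : SkewFamily q N θ) (hN : 3 ≤ N)
    (hν : (q : k) - (q : k)⁻¹ ≠ 0) (i : Fin θ) :
    ∃ r r' : Fin N, (r : ℕ) + 1 = r' ∧ (F.Attached i r r' ∨ F.transpose.Attached i r r') := by
  obtain ⟨⟨a, j⟩, ⟨t, u⟩, hc⟩ := F.exists_ne_zero i
  by_cases ht : t = a
  · by_cases hu : u = j
    · subst ht hu
      exact absurd (F.apply_self i _) hc
    · subst ht
      obtain ⟨r, r', h1, h2⟩ := F.transpose.exists_attached_of_same_col hN hν (i := i)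
        (a := j) (t := u) (j := t) (Ne.symm hu) hc
      exact ⟨r, r', h1, h2.symm⟩
  · by_cases hu : u = j
    · subst hu
      exact F.exists_attached_of_same_col hN hν (Ne.symm ht) hc
    · exact absurd ((F.skew i).mixed_eq_zero (F.ne_zero i) hν hN ht hu) hc

/-- The product of the two mutual ratios is `1`. -/
theorem mul_eq_one (F : SkewFamily q N θ) {i j : Fin θ} (hij : i ≠ j)
    {p b p' b' : Fin N × Fin N} (hi : F.c i p b ≠ 0) (hj : F.c j p' b' ≠ 0) {x y : k}
    (hx : F.s j b = x * F.s j p) (hy : F.s i b' = y * F.s i p') : x * y = 1 := by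
  have e1 : F.χ i j = x := mul_right_cancel₀ (F.ne_zero j p) (by rw [← hx, F.eigen i j p b hi])
  have e2 : F.χ j i = y :=
    mul_right_cancel₀ (F.ne_zero i p') (by rw [← hy, F.eigen j i p' b' hj])
  rw [← e1, ← e2]
  exact F.compat i j hij

theorem chi_eq (F : SkewFamily q N θ) {i j : Fin θ} {p b : Fin N × Fin N}
    (hi : F.c i p b ≠ 0) {x : k} (hx : F.s j b = x * F.s j p) : F.χ i j = x :=
  mul_right_cancel₀ (F.ne_zero j p) (by rw [← hx, F.eigen i j p b hi])

theorem _root_.QMat.IsEdgeTwist.eq_mul {s : Fin N × Fin N → k} {r r' : Fin N}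
    (h : IsEdgeTwist q s r r') (m : Fin N) :
    s (r', m) = ((q : k) ^ 2)⁻¹ * s (r, m) ∧ s (r, m) = (q : k) ^ 2 * s (r', m) := by
  have hq := q.ne_zero
  rw [(h m).1, (h m).2.1]
  constructor <;> field_simp

/-- In every case χ_i(g_i) is q² or q⁻², and its square is not 1. -/
theorem Attached.pow_ne_one {F : SkewFamily q N θ} {i : Fin θ} {r r' : Fin N}
    (h : F.Attached i r r') : (q : k) ^ 4 ≠ 1 := by
  have hχ := F.sq_ne_one i
  cases h with
  | down hs hc =>
    rw [F.chi_eq (hc r) (hs.eq_mul r).1] at hχ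
    intro h4
    exact hχ (by rw [inv_pow, ← pow_mul, h4, inv_one])
  | up hs hc =>
    rwa [F.chi_eq (hc r) (hs.eq_mul r).2, ← pow_mul] at hχ
  | first o e hr ho he hs hs' hc =>
    rwa [F.chi_eq hc hs', ← pow_mul] at hχ
  | last o e hr ho he hs hs' hc =>
    intro h4
    have hq := q.ne_zero
    have e1 : F.s i (e, o) = ((q : k) ^ 2)⁻¹ * F.s i (e, e) := by rw [hs']; field_simp
    rw [F.chi_eq hc e1] at hχ
    exact hχ (by rw [inv_pow, ← pow_mul, h4, inv_one])

/-- Opposite row operations between the same rows do not `q`-commute. -/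
theorem not_down_up (F : SkewFamily q N θ) (hN : 3 ≤ N)
    (hν : (q : k) - (q : k)⁻¹ ≠ 0) (hq4 : (q : k) ^ 4 ≠ 1) {i j : Fin θ} (hij : i ≠ j)
    {r r' : Fin N} (hi : IsEdgeTwist q (F.s i) r r') (hci : ∀ m, F.c i (r, m) (r', m) ≠ 0)
    (hj : IsEdgeTwist q (F.s j) r r') (hcj : ∀ m, F.c j (r', m) (r, m) ≠ 0) : False := by
  have hq := q.ne_zero
  have hq2 : (q : k) ^ 2 ≠ 1 := fun e => hq4 (by linear_combination (q ^ 2 + 1 : k) * e)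
  have hq1 : (q : k) ≠ 1 := fun e => hq2 (by rw [e, one_pow])
  have hqi : (q : k)⁻¹ ≠ 1 := by simpa using hq1
  have hne : r ≠ r' := by
    rintro rfl
    have e := (hi.eq_mul r).2
    exact hq2 (mul_right_cancel₀ (F.ne_zero i (r, r)) (by rw [← e, one_mul]))
  obtain ⟨o, ho⟩ : ∃ o : Fin N, (o : ℕ) = 0 := ⟨⟨0, by omega⟩, rfl⟩
  -- Evaluated at Y_ro, in the first column: the upward map kills it, while down followed by up
  -- returns a nonzero multiple of it.
  have e := F.comm i j hij (r, o) (r, o)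
  have hχi := F.chi_eq (hci o) (hi.eq_mul o).1
  have hχj := F.chi_eq (hcj o) (hj.eq_mul o).2
  have mixed : ∀ (i : Fin θ) (b : Fin N × Fin N), F.c i (r, o) b ≠ 0 → b.1 ≠ r ∧ b.2 = o ∨
      b.1 = r := by
    intro i b hb
    by_contra hcon
    rw [not_or, not_and] at hcon
    exact hb ((F.skew i).mixed_eq_zero (F.ne_zero i) hν hN hcon.2 (hcon.1 hcon.2))
  have hleft : ∀ b, F.c j (r, o) b = 0 := by
    intro b
    by_contra hb
    have e1 := F.eigen j j _ _ hb
    rw [hχj, (hj o).1] at e1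
    obtain ⟨l, m⟩ := b
    rcases mixed j _ hb with ⟨hl, hm⟩ | hl <;> dsimp only at hl
    · obtain rfl : m = o := hm
      by_cases hl' : l = r'
      · rw [hl', (hj m).2.1] at e1
        exact hq4 (by field_simp at e1; exact e1.symm)
      · have hl1 := (hj m).2.2 l hl hl'
        -- The eigenvalue condition alone only gives q³ = 1 here, which is possible, so the
        -- classification of entries within a column is needed.
        rcases lt_or_gt_of_ne hl with hlt | hlt
        · rcases (F.skew j).up_arrow (F.ne_zero j) hν hN hlt hb with ⟨-, h2, -⟩ | ⟨-, -, h3, -⟩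
          · exact hq1 (by rw [← (h2 m).1, hl1])
          · omega
        · rcases (F.skew j).down_arrow (F.ne_zero j) hν hN hlt hb with
            ⟨-, h2, -⟩ | ⟨-, -, -, -, h5⟩
          · exact hqi (by rw [← (h2 m).2.1, hl1])
          · have h6 := (h5 ⟨1, by omega⟩ (Fin.lt_def.mpr (by simp; omega))).1
            rw [(hj _).1] at h6
            exact hq2 (by field_simp at h6; exact h6)
    · rw [hl, (hj m).1] at e1
      exact hq2 (mul_right_cancel₀ hq (by rw [← e1, one_mul]))
  have hright : ∀ b, b ≠ (r', o) → F.c i (r, o) b = 0 := by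
    intro b hbne
    by_contra hb
    have e1 := F.eigen i i _ _ hb
    rw [hχi, (hi o).1] at e1
    obtain ⟨l, m⟩ := b
    rcases mixed i _ hb with ⟨hl, hm⟩ | hl <;> dsimp only at hl
    · obtain rfl : m = o := hm
      rw [(hi m).2.2 l hl (fun h => hbne (by rw [h]))] at e1
      exact hq1 (by field_simp at e1; exact e1)
    · rw [hl, (hi m).1] at e1
      exact hq2 (by field_simp at e1; exact e1)
  rw [Finset.sum_eq_zero (fun b _ => by rw [hleft b, zero_mul]),
    Finset.sum_eq_single (r', o) (fun b _ hb => by rw [hright b hb, zero_mul]) (by simp)] at e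
  have hχ : F.χ j i ≠ 0 := right_ne_zero_of_mul_eq_one (F.compat i j hij)
  exact mul_ne_zero hχ (mul_ne_zero (hci o) (hcj o)) e.symm

/-- At most one member of the family is attached to a given pair of adjacent rows. -/
theorem Attached.unique {F : SkewFamily q N θ} (hN : 3 ≤ N)
    (hν : (q : k) - (q : k)⁻¹ ≠ 0) {i j : Fin θ} {r r' : Fin N} (hr : (r : ℕ) + 1 = r')
    (hi : F.Attached i r r') (hj : F.Attached j r r') : i = j := by
  by_contra hij
  have hq := q.ne_zero
  have hq4 := hi.pow_ne_one
  have hq2 : (q : k) ^ 2 ≠ 1 := fun e => hq4 (by linear_combination (q ^ 2 + 1 : k) * e)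
  have inv : ∀ {x y : k}, x = (q : k) ^ 2 * y → y = ((q : k) ^ 2)⁻¹ * x := by
    rintro x y rfl; field_simp
  have i4 : ((q : k) ^ 2)⁻¹ * ((q : k) ^ 2)⁻¹ ≠ 1 := by
    intro e; field_simp at e; exact hq4 e.symm
  have p4 : (q : k) ^ 2 * (q : k) ^ 2 ≠ 1 := by rwa [← pow_add]
  have p2 : (q : k) ^ 2 * 1 ≠ 1 := by rwa [mul_one]
  have i2 : ((q : k) ^ 2)⁻¹ * 1 ≠ 1 := by simpa using hq2
  have top : ∀ {s : Fin N × Fin N → k}, IsEdgeTwist q s r r' → ∀ m m', s (r, m) = 1 * s (r, m') :=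
    fun h m m' => by rw [(h m).1, (h m').1, one_mul]
  have bot : ∀ {s : Fin N × Fin N → k}, IsEdgeTwist q s r r' →
      ∀ m m', s (r', m) = 1 * s (r', m') :=
    fun h m m' => by rw [(h m).2.1, (h m').2.1, one_mul]
  have hji : j ≠ i := Ne.symm hij
  cases hi with
  | down si ci =>
    cases hj with
    | down sj cj => exact i4 (F.mul_eq_one hij (ci r) (cj r) (sj.eq_mul r).1 (si.eq_mul r).1)
    | up sj cj => exact F.not_down_up hN hν hq4 hij si ci sj cj
    | first o e hr ho he hs hs' hc =>
      subst hr
      exact p2 (F.mul_eq_one hij (ci r) hc (hs r) (top si _ _))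
    | last o e hr ho he hs hs' hc =>
      subst hr
      exact p2 (F.mul_eq_one hij (ci r) hc (hs r) (bot si _ _))
  | up si ci =>
    cases hj with
    | down sj cj => exact F.not_down_up hN hν hq4 hji sj cj si ci
    | up sj cj => exact p4 (F.mul_eq_one hij (ci r) (cj r) (sj.eq_mul r).2 (si.eq_mul r).2)
    | first o e hr ho he hs hs' hc =>
      subst hr
      exact i2 (F.mul_eq_one hij (ci r) hc (inv (hs r)) (top si _ _))
    | last o e hr ho he hs hs' hc =>
      subst hr
      exact i2 (F.mul_eq_one hij (ci r) hc (inv (hs r)) (bot si _ _))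
  | first o e hr ho he hs hs' hc =>
    cases hj with
    | down sj cj =>
      subst hr
      exact p2 (F.mul_eq_one hji (cj r) hc (hs r) (top sj _ _))
    | up sj cj =>
      subst hr
      exact i2 (F.mul_eq_one hji (cj r) hc (inv (hs r)) (top sj _ _))
    | first o₂ e₂ hr₂ ho₂ he₂ hs₂ hs₂' hc₂ =>
      obtain rfl : o = o₂ := Fin.ext (by omega)
      obtain rfl : e = e₂ := Fin.ext (by omega)
      exact p4 (F.mul_eq_one hij hc hc₂ hs₂' hs')
    | last o₂ e₂ hr₂ ho₂ he₂ hs₂ hs₂' hc₂ =>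
      subst hr hr₂
      -- The pair would consist of the first and the last row, which are not adjacent since N ≥ 3.
      omega
  | last o e hr ho he hs hs' hc =>
    cases hj with
    | down sj cj =>
      subst hr
      exact p2 (F.mul_eq_one hji (cj r) hc (hs r) (bot sj _ _))
    | up sj cj =>
      subst hr
      exact i2 (F.mul_eq_one hji (cj r) hc (inv (hs r)) (bot sj _ _))
    | first o₂ e₂ hr₂ ho₂ he₂ hs₂ hs₂' hc₂ =>
      subst hr hr₂
      omega
    | last o₂ e₂ hr₂ ho₂ he₂ hs₂ hs₂' hc₂ =>
      obtain rfl : o = o₂ := Fin.ext (by omega)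
      obtain rfl : e = e₂ := Fin.ext (by omega)
      exact i4 (F.mul_eq_one hij hc hc₂ (inv hs₂') (inv hs'))

theorem card_le (F : SkewFamily q N θ) (hN : 3 ≤ N) (hν : (q : k) - (q : k)⁻¹ ≠ 0) :
    θ ≤ 2 * N - 2 := by
  choose r r' hr hatt using F.exists_attached hN hν
  -- The Boolean separates rows from columns, with rows preferred; a pair of adjacent lines is
  -- recorded by its smaller index, of which there are N - 1.
  let f : Fin θ → Bool × Fin (N - 1) := fun i =>
    (@decide (F.Attached i (r i) (r' i)) (Classical.dec _), ⟨r i, by have := hr i; omega⟩)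
  have hf : Function.Injective f := by
    intro i j hij
    obtain ⟨h1, h2⟩ := Prod.ext_iff.mp hij
    simp only [f, decide_eq_decide, Fin.mk.injEq] at h1 h2
    have e1 : r i = r j := Fin.ext h2
    have e2 : r' i = r' j := Fin.ext (by rw [← hr, ← hr, h2])
    by_cases hi : F.Attached i (r i) (r' i)
    · have hj := h1.mp hi
      rw [← e1, ← e2] at hj
      exact hi.unique hN hν (hr i) hj
    · have hj := (hatt j).resolve_left fun hj => hi (h1.mpr hj)
      rw [← e1, ← e2] at hj
      exact ((hatt i).resolve_left hi).unique hN hν (hr i) hj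
  have := Fintype.card_le_of_injective f hf
  simp only [Fintype.card_fin, Fintype.card_prod, Fintype.card_bool] at this
  omega

end SkewFamily

end QMat

/-! ### Monomial automorphisms and linear coefficients -/

namespace QMat

variable {k : Type*} [Field k] {N : ℕ} {q : kˣ}

/-- Elements of `(kˣ)^(2 N - 1) ⋊ ⟨τ⟩` act on the generators monomially. -/
theorem apply_gen_of_mem_torusTranspose {φ : QMat N q ≃ₐ[k] QMat N q}
    (h : φ ∈ torusTranspose q N) : ∃ a b : Fin N → kˣ,
      (∀ p, φ (gen q p) = ((a p.1 : k) * b p.2) • gen q p) ∨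
      (∀ p, φ (gen q p) = ((a p.1 : k) * b p.2) • gen q p.swap) := by
  induction h using Subgroup.closure_induction with
  | mem φ hφ =>
    rcases hφ with ⟨a, b, -, rfl⟩ | rfl
    · exact ⟨a, b, .inl fun p => torusAut_Y q a b p.1 p.2⟩
    · exact ⟨1, 1, .inr fun p => by
        simpa using! transposeAut_Y q p.1 p.2⟩
  | one => exact ⟨1, 1, .inl fun p => by simp⟩
  | mul φ ψ _ _ hφ hψ =>
    obtain ⟨a, b, hφ⟩ := hφ
    obtain ⟨a', b', hψ⟩ := hψ
    rcases hφ with hφ | hφ <;> rcases hψ with hψ | hψ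
    · exact ⟨a * a', b * b', .inl fun p => by
        rw [AlgEquiv.mul_apply, hψ, map_smul, hφ, smul_smul]
        congr 1; simp; ring⟩
    · exact ⟨b * a', a * b', .inr fun p => by
        rw [AlgEquiv.mul_apply, hψ, map_smul, hφ, smul_smul]
        congr 1; simp; ring⟩
    · exact ⟨a * a', b * b', .inr fun p => by
        rw [AlgEquiv.mul_apply, hψ, map_smul, hφ, smul_smul]
        congr 1; simp; ring⟩
    · exact ⟨b * a', a * b', .inl fun p => by
        rw [AlgEquiv.mul_apply, hψ, map_smul, hφ, smul_smul, Prod.swap_swap]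
        congr 1; simp; ring⟩
  | inv φ _ hφ =>
    obtain ⟨a, b, hφ⟩ := hφ
    have key : ∀ (x : k) (y z : QMat N q), x ≠ 0 → φ y = x • z → φ⁻¹ z = x⁻¹ • y := by
      intro x y z hx hy
      have e : φ (x⁻¹ • y) = z := by rw [map_smul, hy, smul_smul, inv_mul_cancel₀ hx, one_smul]
      rw [← e]
      exact φ.symm_apply_apply _
    rcases hφ with hφ | hφ
    · exact ⟨a⁻¹, b⁻¹, .inl fun p => by
        rw [key _ _ _ (mul_ne_zero (a p.1).ne_zero (b p.2).ne_zero) (hφ p)]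
        congr 1; simp [mul_comm]⟩
    · exact ⟨b⁻¹, a⁻¹, .inr fun p => by
        have e := hφ p.swap
        rw [Prod.swap_swap] at e
        rw [key _ _ _ (mul_ne_zero (a p.swap.1).ne_zero (b p.swap.2).ne_zero) e]
        congr 1; simp [mul_comm]⟩

theorem gen_mem_degreeOne (p : Fin N × Fin N) : gen q p ∈ degreeOne q N :=
  Submodule.subset_span ⟨p, rfl⟩

theorem exists_coeff_of_mem_degreeOne {y : QMat N q} (h : y ∈ degreeOne q N) :
    ∃ c : Fin N × Fin N → k, y = ∑ b, c b • gen q b := by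
  obtain ⟨c, hc⟩ := (Submodule.mem_span_range_iff_exists_fun k).mp h
  exact ⟨c, hc.symm⟩

theorem coeff_unique {c d : Fin N × Fin N → k} (h : ∑ b, c b • gen q b = ∑ b, d b • gen q b)
    (b : Fin N × Fin N) : c b = d b :=
  congrFun (Fintype.linearIndependent_iffₛ.mp linearIndependent_gen c d h |> funext) b

end QMat

/-! ### From a Hopf action to a family of skew derivations -/

namespace HopfAction

open QMat

variable {k G : Type*} [Field k] [CommGroup G] {θ N : ℕ} {q : kˣ} {D : QLSDatum k G θ}
  (ρ : HopfAction k D.Boson (QMat N q))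

theorem act_x_mul (i : Fin θ) (a b : QMat N q) : ρ.act (D.x i) (a * b) =
    ρ.act (D.grp (D.g i)) a * ρ.act (D.x i) b + ρ.act (D.x i) a * b := by
  rw [ρ.act_mul, QLSDatum.comul_eq, QLSDatum.comulHom_x]
  simp

theorem act_x_one (i : Fin θ) : ρ.act (D.x i) 1 = 0 := by
  rw [ρ.act_one, QLSDatum.counit_eq, QLSDatum.counitHom_x, map_zero]

/-- By the skew Leibniz rule and x_i · 1 = 0, the action of x_i is determined by its values on the
generators. -/
theorem act_x_eq_zero {i : Fin θ} (h : ∀ p, ρ.act (D.x i) (gen q p) = 0) :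
    ρ.act (D.x i) = 0 := by
  let f : FreeAlgebra k (Fin N × Fin N) →ₐ[k] QMat N q := RingQuot.mkAlgHom k (QMatRel N q)
  have hf : ∀ a, ρ.act (D.x i) (f a) = 0 := by
    intro a
    induction a using FreeAlgebra.induction with
    | grade0 c =>
      rw [AlgHom.commutes, Algebra.algebraMap_eq_smul_one, map_smul, act_x_one, smul_zero]
    | grade1 p => exact h p
    | mul a b iha ihb =>
      rw [map_mul, act_x_mul, iha, ihb, mul_zero, zero_mul, add_zero]
    | add a b iha ihb => rw [map_add, map_add, iha, ihb, add_zero]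
  refine LinearMap.ext fun y => ?_
  obtain ⟨a, rfl⟩ := RingQuot.mkAlgHom_surjective k (QMatRel N q) y
  exact hf a

theorem act_grp_act_x (h : G) (i : Fin θ) (y : QMat N q) :
    ρ.act (D.grp h) (ρ.act (D.x i) y) =
      (D.χ i h : k) • ρ.act (D.x i) (ρ.act (D.grp h) y) := by
  have e := congrArg (fun z => ρ.act z y) (D.grp_mul_x h i)
  simpa only [map_mul, map_smul, Module.End.mul_apply, LinearMap.smul_apply] using e

theorem act_x_act_x {i j : Fin θ} (hij : i ≠ j) (y : QMat N q) :
    ρ.act (D.x i) (ρ.act (D.x j) y) =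
      (D.χ j (D.g i) : k) • ρ.act (D.x j) (ρ.act (D.x i) y) := by
  have e := congrArg (fun z => ρ.act z y) (D.x_mul_x i j hij)
  simpa only [map_mul, map_smul, Module.End.mul_apply, LinearMap.smul_apply] using e

theorem isSkew {i : Fin θ} {π : Fin N × Fin N → Fin N × Fin N} {s : Fin N × Fin N → k}
    {c : Fin N × Fin N → Fin N × Fin N → k}
    (hs : ∀ p, ρ.act (D.grp (D.g i)) (gen q p) = s p • gen q (π p))
    (hc : ∀ p, ρ.act (D.x i) (gen q p) = ∑ b, c p b • gen q b) : IsSkew q π s c :=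
  ⟨ρ.act (D.x i), hc, fun p r => by rw [ρ.act_x_mul, hs, smul_mul_assoc]⟩

theorem chi_sq_ne_one (D : QLSDatum k G θ) (hm : ∀ i, D.m i ≠ 2) (i : Fin θ) :
    (D.χ i (D.g i) : k) ^ 2 ≠ 1 := by
  intro h
  have h1 : (D.χ i (D.g i)) ^ 2 = 1 := Units.ext (by simpa using h)
  have h2 := orderOf_le_of_pow_eq_one two_pos h1
  have h3 := D.two_le_orderOf i
  exact hm i (le_antisymm h2 h3)

/-- A nonzero skew derivation that is linear on the generators and whose parameter is not a sign
has no twist in the nontrivial coset of the torus. -/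
theorem not_swap (hN : 3 ≤ N) {i : Fin θ} (hχ : (D.χ i (D.g i) : k) ^ 2 ≠ 1)
    {s : Fin N × Fin N → k} (hs0 : ∀ p, s p ≠ 0) {c : Fin N × Fin N → Fin N × Fin N → k}
    (hs : ∀ p, ρ.act (D.grp (D.g i)) (gen q p) = s p • gen q p.swap)
    (hc : ∀ p, ρ.act (D.x i) (gen q p) = ∑ b, c p b • gen q b) : ρ.act (D.x i) = 0 := by
  have h := ρ.isSkew hs hc
  have e1 : ∀ p b, c p b * s b = D.χ i (D.g i) * (s p * c p.swap b.swap) := by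
    intro p b
    have e := ρ.act_grp_act_x (D.g i) i (gen q p)
    rw [hs, map_smul, hc, hc, map_sum] at e
    simp only [map_smul, hs, smul_smul, Finset.smul_sum] at e
    rw [← Equiv.sum_comp (Equiv.prodComm _ _)] at e
    have e2 := coeff_unique (by simpa using e) b.swap
    simpa [mul_assoc] using e2
  -- Here s p * s p.swap is the eigenvalue of g_i² on Y_p. Two uses of `e1` give c p b = χ_i(g_i)² c
  -- p b when the eigenvalues agree.
  have key : ∀ p b, s b * s b.swap = s p * s p.swap → c p b = 0 := by
    intro p b hpb
    have f1 := e1 p b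
    have f2 := e1 p.swap b.swap
    simp only [Prod.swap_swap] at f2
    have f3 : ((D.χ i (D.g i) : k) ^ 2 - 1) * (s p * s p.swap) * c p b = 0 := by
      linear_combination -s b.swap * f1 - D.χ i (D.g i) * s p * f2 + c p b * hpb
    exact (mul_eq_zero.mp f3).resolve_left
      (mul_ne_zero (sub_ne_zero.mpr hχ) (mul_ne_zero (hs0 _) (hs0 _)))
  have hz := h.swap_eq_zero hs0 (fun p => key p p rfl)
    (fun p => key p p.swap (by rw [Prod.swap_swap, mul_comm]))
    (o := ⟨0, by omega⟩) (e := ⟨N - 1, by omega⟩) (u := ⟨1, by omega⟩)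
    (fun i => Fin.le_def.mpr (by simp)) (fun i => Fin.le_def.mpr (by simp; omega))
    (Fin.lt_def.mpr (by simp; omega)) (Fin.lt_def.mpr (by simp)) (Fin.lt_def.mpr (by simp; omega))
  exact ρ.act_x_eq_zero fun p => by simp [hc, hz]

theorem exists_skewFamily (hN : 3 ≤ N) (hm : ∀ i, D.m i ≠ 2)
    (hg : ∀ i, ∃ φ ∈ QMat.torusTranspose q N, ∀ y, ρ.act (D.grp (D.g i)) y = φ y)
    (hlin : ∀ i, ∀ y ∈ QMat.degreeOne q N, ρ.act (D.x i) y ∈ QMat.degreeOne q N)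
    (hx : ∀ i, ρ.act (D.x i) ≠ 0) : Nonempty (SkewFamily q N θ) := by
  choose φ hφ hact using hg
  choose a b hab using fun i => apply_gen_of_mem_torusTranspose (hφ i)
  choose c hc using fun i p =>
    exists_coeff_of_mem_degreeOne (hlin i _ (gen_mem_degreeOne (q := q) p))
  have hs0 : ∀ i (p : Fin N × Fin N), (a i p.1 : k) * b i p.2 ≠ 0 := fun i p =>
    mul_ne_zero (a i p.1).ne_zero (b i p.2).ne_zero
  have hs : ∀ i (p : Fin N × Fin N), ρ.act (D.grp (D.g i)) (gen q p) =
      ((a i p.1 : k) * b i p.2) • gen q p := by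
    intro i p
    rcases hab i with h | h
    · rw [hact, h]
    · exact absurd (ρ.not_swap hN (chi_sq_ne_one D hm i) (hs0 i)
        (fun p => by rw [hact, h]) (hc i)) (hx i)
  exact ⟨{
    s := fun i p => (a i p.1 : k) * b i p.2
    c := c
    χ := fun i j => D.χ i (D.g j)
    skew := fun i => ρ.isSkew (hs i) (hc i)
    ne_zero := hs0
    rank_one := fun i l m l' m' => by ring
    eigen := fun i j p r hpr => by
      have e := ρ.act_grp_act_x (D.g j) i (gen q p)
      rw [hs, map_smul, hc, map_sum] at e
      simp only [map_smul, hs, smul_smul, Finset.smul_sum] at e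
      have e2 := coeff_unique e r
      exact mul_left_cancel₀ hpr (by linear_combination e2)
    compat := fun i j hij => D.chi_mul_chi i j hij
    sq_ne_one := chi_sq_ne_one D hm
    comm := fun i j hij p r => by
      have e := ρ.act_x_act_x hij (gen q p)
      rw [hc, hc, map_sum, map_sum] at e
      simp only [map_smul, hc, Finset.smul_sum, smul_smul] at e
      rw [Finset.sum_comm, Finset.sum_comm (f := fun x y => (_ * (_ * _)) • _)] at e
      simp only [← Finset.sum_smul] at e
      rw [coeff_unique e r, Finset.mul_sum]
    exists_ne_zero := fun i => by
      by_contra hcon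
      push Not at hcon
      exact hx i (ρ.act_x_eq_zero fun p => by simp [hc, hcon]) }⟩

end HopfAction

theorem mainTheorem2 {k : Type*} [Field k] [IsAlgClosed k] [CharZero k]
    {G : Type*} [CommGroup G] [Finite G] {θ N : ℕ} (hN : 3 ≤ N)
    (q : kˣ) (hq1 : q ≠ 1) (hq2 : q ≠ -1)
    (D : QLSDatum k G θ) (hm : ∀ i, D.m i ≠ 2)
    (ρ : HopfAction k D.Boson (QMat N q))
    (hg : ∀ i, ∃ φ ∈ QMat.torusTranspose q N, ∀ y, ρ.act (D.grp (D.g i)) y = φ y)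
    (hlin : ∀ i, ∀ y ∈ QMat.degreeOne q N, ρ.act (D.x i) y ∈ QMat.degreeOne q N)
    (hx : ∀ i, ρ.act (D.x i) ≠ 0) :
    θ ≤ 2 * N - 2 := by
  obtain ⟨F⟩ := ρ.exists_skewFamily hN hm hg hlin hx
  -- It remains to see that ν ≠ 0: otherwise q² = 1.
  refine F.card_le hN fun h => ?_
  have hq := q.ne_zero
  have h1 : (q : k) * q = 1 := by
    nth_rewrite 2 [sub_eq_zero.mp h]
    exact mul_inv_cancel₀ hq
  rcases mul_self_eq_one_iff.mp h1 with h2 | h2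
  · exact hq1 (Units.ext h2)
  · exact hq2 (Units.ext (by simpa using h2))
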